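/- All words are over the alphabet $\mathbb{N}=\{0,1,2,\dots\}$, and strings of digits denote words whose letters are the digits. For a finite word $w$ let $L(w)$ be the lexicographically least infinite word that begins with $w$ and whose only square factors lie inside the prefix $w$ (so $L(1)$ is the lexicographically least square-free infinite word starting with $1$). For a finite word $w$, $w[i{:}]$ is $w$ without its first $i$ letters, $w[{:}-i]$ is $w$ without its last $i$ letters, $w[-i{:}]$ is the suffix of $w$ of length $i$, $w[i{:}-j]$ is $w$ without its first $i$ and last $j$ letters, and, for $w$ nonempty, $w^+$ is $w$ with its last letter increased by $1$. Let $\rho$ be the morphism $\rho(n)=0\,(n+1)$, let $R_n=\rho^n(0)$, and let the ruler sequence $\rho^\infty(0)=0102010301020104\cdots$ be the infinite word having every $R_n$ as a prefix. Let $P_0(n)$ be the longest prefix of the ruler sequence such that $n\,P_0(n)$ is a prefix of $L(n)$. Define morphisms by \[\psi_1(0)=202101,\qquad \psi_1(n)=(n+1)\,P_0(n+1)\quad(n\ge 1),\] \[\psi_2(n)=(n+2)\,P_0(n+2)\,\psi_1(P_0(n+1))\quad (n\ge 1),\] \begin{align*}\psi_2(0)={}&2021020102101201020120210120102013010201030102012021012010201\\&2021013010201030102012021012010201202301020103010201202101201\\&0201203010201030102030103020102030102010301020301030201202101\\&2010201202101202.\end{align*}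 Put \begin{align*} C&=0102030102,\\ B_0&=0301\;\psi_1(1010)[{:}-3]\;\psi_2(1010)[{:}-6]\;\psi_2(10)[{:}-12]\;301020,\\ B_1&=\rho(B_0[7{:}-5]),\\ E&=0102\,B_0\,1\,B_0[{:}-9],\\ F&=B_0[-9{:}]\;3010302\;C\;0103\;C^+\;02, \end{align*} and let $\alpha$ be the (non-erasing) morphism \[\alpha(0)=EFE,\qquad \alpha(1)=B_1\,R_4\,C\,B_1\,R_4,\qquad \alpha(n)=\alpha(n-1)^+\,R_{n+3}\,C\,\alpha(n-1)^+\,R_{n+3}\quad(n\ge 2).\] \textbf{Theorem.} Let $Y_1$ be the prefix of $L(1)$ of length $5177$. Then $L(1)=Y_1\,\alpha(L(\varepsilon))$, where $L(\varepsilon)$, the lexicographically least square-free infinite word, is the ruler sequence. -/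

import Mathlib

namespace SqFree

/- Finite words over ℕ are lists, infinite words are functions ℕ → ℕ, letters are indexed from 0,
and a morphism is given by the images φ : ℕ → List ℕ of the letters. -/

/-- The prefix of length k of an infinite word. -/
def prefixOf (x : ℕ → ℕ) (k : ℕ) : List ℕ := (List.range k).map x

/-- The infinite word obtained by writing the infinite word x after the finite word u. -/
def append (u : List ℕ) (x : ℕ → ℕ) : ℕ → ℕ := fun i =>
  if h : i < u.length then u[i] else x (i - u.length)

theorem le_length_flatMap_prefixOf (φ : ℕ → List ℕ) (hφ : ∀ n, φ n ≠ []) (x : ℕ → ℕ) (k : ℕ) :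
    k ≤ ((prefixOf x k).flatMap φ).length := by
  induction k with
  | zero => exact Nat.zero_le _
  | succ k ih =>
    have h : 0 < (φ (x k)).length := List.length_pos_of_ne_nil (hφ _)
    simp only [prefixOf, List.range_succ, List.map_append, List.flatMap_append,
      List.length_append, List.map_cons, List.map_nil, List.flatMap_cons, List.flatMap_nil,
      List.length_nil] at ih ⊢
    omega

/-- The image φ(x) = φ(x 0) φ(x 1) φ(x 2) ⋯ of an infinite word x under a non-erasing morphism φ:
its letter of index i is read off from φ(x 0) ⋯ φ(x i), whose length exceeds i. -/
def image (φ : ℕ → List ℕ) (hφ : ∀ n, φ n ≠ []) (x : ℕ → ℕ) : ℕ → ℕ := fun i =>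
  ((prefixOf x (i + 1)).flatMap φ)[i]'(le_length_flatMap_prefixOf φ hφ x (i + 1))

/-! ### The lexicographically least word L(w) -/

/-- The infinite word x begins with w, and each square occurring in x lies inside this prefix. -/
def SquaresOnlyIn (w : List ℕ) (x : ℕ → ℕ) : Prop :=
  prefixOf x w.length = w ∧
  ∀ i l : ℕ, 0 < l → (∀ j < l, x (i + j) = x (i + l + j)) → i + 2 * l ≤ w.length

/-- x is the least element, in the lexicographic order on infinite words, of the set of infinite
words beginning with w all of whose squares lie inside that prefix. -/
def IsLexLeast (w : List ℕ) (x : ℕ → ℕ) : Prop :=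
  IsLeast {y : Lex (ℕ → ℕ) | SquaresOnlyIn w (ofLex y)} (toLex x)

theorem squaresOnlyIn_nonempty (w : List ℕ) : ∃ x, SquaresOnlyIn w x := by
  refine ⟨fun i => if h : i < w.length then w[i] else w.sum + i + 1, ?_, ?_⟩
  · apply List.ext_getElem
    · simp [prefixOf]
    · intro i h1 h2
      simp [prefixOf, h2]
  · intro i l hl h
    by_contra hlt
    have h := h (l - 1) (by omega)
    have h2 : ¬ (i + l + (l - 1) < w.length) := by omega
    simp only [h2, dite_false] at h
    split_ifs at h with h3
    · have := List.le_sum_of_mem (List.getElem_mem h3)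
      omega
    · omega

theorem exists_isLexLeast (w : List ℕ) : ∃ x, IsLexLeast w x := by
  classical
  -- letter by letter, the least letter that extends the prefix chosen so far inside the set
  let F : (n : ℕ) → ((m : ℕ) → m < n → ℕ) → ℕ := fun n p =>
    sInf {a | ∃ y, SquaresOnlyIn w y ∧ (∀ j (hj : j < n), y j = p j hj) ∧ y n = a}
  let x : ℕ → ℕ := fun n => Nat.strongRec (motive := fun _ => ℕ) F n
  have hx : ∀ n, x n = sInf {a | ∃ y, SquaresOnlyIn w y ∧ (∀ j < n, y j = x j) ∧ y n = a} := by
    intro n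
    show Nat.strongRec (motive := fun _ => ℕ) F n = _
    rw [Nat.strongRec_eq]
  have key : ∀ n, ∃ y, SquaresOnlyIn w y ∧ ∀ j < n, y j = x j := by
    intro n
    induction n with
    | zero =>
      obtain ⟨y, hy⟩ := squaresOnlyIn_nonempty w
      exact ⟨y, hy, fun j hj => absurd hj (Nat.not_lt_zero j)⟩
    | succ n ih =>
      obtain ⟨y, hy, hyx⟩ := ih
      have hm := Nat.sInf_mem
        (s := {a | ∃ y, SquaresOnlyIn w y ∧ (∀ j < n, y j = x j) ∧ y n = a}) ⟨y n, y, hy, hyx, rfl⟩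
      rw [← hx n] at hm
      obtain ⟨z, hz, hzx, hzn⟩ := hm
      refine ⟨z, hz, fun j hj => ?_⟩
      rcases Nat.lt_succ_iff_lt_or_eq.1 hj with h | h
      · exact hzx j h
      · rw [h, hzn]
  refine ⟨x, ⟨?_, ?_⟩, ?_⟩
  · obtain ⟨y, hy, hyx⟩ := key w.length
    refine Eq.trans ?_ hy.1
    refine List.map_congr_left fun j hj => ?_
    exact (hyx j (List.mem_range.1 hj)).symm
  · intro i l hl h
    obtain ⟨y, hy, hyx⟩ := key (i + 2 * l)
    refine hy.2 i l hl fun j hj => ?_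
    rw [hyx _ (by omega), hyx _ (by omega)]
    exact h j hj
  · intro y hy
    by_contra hlt
    obtain ⟨i, hi, hlt⟩ := not_le.1 hlt
    have h1 : x i ≤ ofLex y i := by
      rw [hx i]
      exact Nat.sInf_le ⟨ofLex y, hy, fun j hj => hi j hj, rfl⟩
    exact absurd hlt (not_lt.2 h1)

/-- L(w): the lexicographically least infinite word beginning with w whose only squares lie inside
the prefix w. -/
noncomputable def L (w : List ℕ) : ℕ → ℕ := Classical.choose (exists_isLexLeast w)

theorem L_spec (w : List ℕ) : IsLexLeast w (L w) := Classical.choose_spec (exists_isLexLeast w)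

/-! ### The ruler sequence -/

/-- The ruler morphism. -/
def rho (n : ℕ) : List ℕ := [0, n + 1]

/-- The words R n = ρⁿ(0). -/
def R : ℕ → List ℕ
  | 0 => [0]
  | n + 1 => (R n).flatMap rho

theorem length_R (n : ℕ) : (R n).length = 2 ^ n := by
  induction n with
  | zero => rfl
  | succ n ih => simp [R, rho, List.length_flatMap, ih, pow_succ]

/-- The ruler sequence 0102010301020104⋯, the limit of the words ρⁿ(0). -/
def ruler : ℕ → ℕ := fun i => (R i)[i]'(by rw [length_R]; exact Nat.lt_two_pow_self)

/-! ### The morphism α -/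

/-- The successor of a nonempty word: its last letter is increased by 1. -/
def succWord : List ℕ → List ℕ
  | [] => []
  | [a] => [a + 1]
  | a :: b :: w => a :: succWord (b :: w)

/-- The longest prefix p of the ruler sequence such that n p is a prefix of L(n). -/
noncomputable def P0 (n : ℕ) : List ℕ :=
  prefixOf ruler (sSup {k | prefixOf (L [n]) (k + 1) = n :: prefixOf ruler k})

noncomputable def psi1 (n : ℕ) : List ℕ :=
  if n = 0 then [2, 0, 2, 1, 0, 1] else (n + 1) :: P0 (n + 1)

/-- Only used for n ≥ 3. -/
noncomputable def P1 (n : ℕ) : List ℕ := (P0 (n - 1)).flatMap psi1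

noncomputable def psi2 (n : ℕ) : List ℕ :=
  if n = 0 then
   [2, 0, 2, 1, 0, 2, 0, 1, 0, 2, 1, 0, 1, 2, 0, 1, 0, 2, 0, 1, 2, 0, 2, 1, 0,
    1, 2, 0, 1, 0, 2, 0, 1, 3, 0, 1, 0, 2, 0, 1, 0, 3, 0, 1, 0, 2, 0, 1, 2, 0,
    2, 1, 0, 1, 2, 0, 1, 0, 2, 0, 1, 2, 0, 2, 1, 0, 1, 3, 0, 1, 0, 2, 0, 1, 0,
    3, 0, 1, 0, 2, 0, 1, 2, 0, 2, 1, 0, 1, 2, 0, 1, 0, 2, 0, 1, 2, 0, 2, 3, 0,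
    1, 0, 2, 0, 1, 0, 3, 0, 1, 0, 2, 0, 1, 2, 0, 2, 1, 0, 1, 2, 0, 1, 0, 2, 0,
    1, 2, 0, 3, 0, 1, 0, 2, 0, 1, 0, 3, 0, 1, 0, 2, 0, 3, 0, 1, 0, 3, 0, 2, 0,
    1, 0, 2, 0, 3, 0, 1, 0, 2, 0, 1, 0, 3, 0, 1, 0, 2, 0, 3, 0, 1, 0, 3, 0, 2,
    0, 1, 2, 0, 2, 1, 0, 1, 2, 0, 1, 0, 2, 0, 1, 2, 0, 2, 1, 0, 1, 2, 0, 2]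
  else (n + 2) :: (P0 (n + 2) ++ P1 (n + 2))

def C : List ℕ := [0, 1, 0, 2, 0, 3, 0, 1, 0, 2]

noncomputable def B0 : List ℕ :=
  [0, 3, 0, 1] ++ ([1, 0, 1, 0].flatMap psi1).rdrop 3 ++ ([1, 0, 1, 0].flatMap psi2).rdrop 6 ++
    ([1, 0].flatMap psi2).rdrop 12 ++ [3, 0, 1, 0, 2, 0]

noncomputable def B1 : List ℕ := ((B0.drop 7).rdrop 5).flatMap rho

noncomputable def E : List ℕ := [0, 1, 0, 2] ++ B0 ++ [1] ++ B0.rdrop 9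

noncomputable def F : List ℕ :=
  B0.rtake 9 ++ [3, 0, 1, 0, 3, 0, 2] ++ C ++ [0, 1, 0, 3] ++ succWord C ++ [0, 2]

noncomputable def alpha : ℕ → List ℕ
  | 0 => E ++ F ++ E
  | 1 => B1 ++ R 4 ++ C ++ B1 ++ R 4
  | n + 2 => succWord (alpha (n + 1)) ++ R (n + 5) ++ C ++ succWord (alpha (n + 1)) ++ R (n + 5)

theorem alpha_ne_nil : ∀ n, alpha n ≠ []
  | 0 => by simp [alpha, E]
  | 1 => by simp [alpha, C]
  | n + 2 => by simp [alpha, C]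

/-- The prefix of length 5177 of L(1). -/
noncomputable def Y1 : List ℕ := prefixOf (L [1]) 5177

end SqFree

/-!
A fresh letter never completes a square, so `L(w)` is produced letter by letter: each letter after
`w` is the least one completing no square. Hence it suffices to show that the finite words
`Y1 α(u)`, for `u` the ruler word `R n` without its last letter, are square-free and *greedy*: each
smaller letter in place of a letter completes a square (`prefixOf_L`, `GreedyAfter`). The same
criterion, with `R n R n` as the square that forces the last letter of `R (n + 1)`, identifies
`L(ε)` with the ruler sequence.

Write `α(n) = K n (n + 3)` for `n ≥ 1` and `B1 = K 0 4`, where `K n` is `alphaCore n`, and let `r`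
be `R (n + 4)` without its last letter. With `m = n + 4`, the recursion for `α` reads
`K (n + 1) = K n m r m C K n m r`. For `n ≥ 1` the letter `m` occurs only where it is displayed.

*Square-freeness* of `Y1 α(R (n + 1)⁻) K n` and `C K n`, where `⁻` removes the last letter, is
proved by induction on `n`. For `n = 1` it is a computation on a word of 18000 letters. For the
step, the words for `n + 1` are cut at the letters `m` into pieces that are square-free by
induction. A square containing `m` would write one of the pieces as a product of a prefix of a later
piece and a suffix of an earlier one (`exists_pieces_of_square`). This is excluded because `r` and
`K n` have a common suffix that lacks exactly six letters of `r` (`exists_common_suffix`), while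
`r = 010201⋯`, `C = 0102030102` and `α(0) = 010203012⋯` part early, and because `C` and `α(0)` end
in `02` and `12`.

*Greediness* inside `α(0)` and `B1` is local and is verified by computation. The remaining squares
have unbounded periods: a square of period `2 ^ (n + 4)` forces the letter 3 in the prefix `010203`
of `C` and of `α(0)` after `K n m r m` (`greedyAfter_common_prefix`), the square of
`2 K n m r m 010203010` forces `α(0)` to depart from `C` after `α(n + 1)`
(`greedyAfter_alpha_alphaZero`), the square of `C K n m r m` increases the last letter of the second
half of `α(n + 2)` (`greedyAfter_C_alphaCore`), and the squares `α(R n R n)` increase that of the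
first half (`greedyAfter_imagePrefix_alphaCore`).

The computations encode words as large numbers, so that the kernel compares long factors in a few
arithmetic operations.
-/

namespace SqFree

/-! ### Squares in finite words and the greedy construction -/

/-- The finite word `w` has no nonempty factor of the form `u u`. -/
def SquareFree (w : List ℕ) : Prop := ∀ u, u ≠ [] → ¬ u ++ u <:+: w

/-- Some nonempty square `u u` is a suffix of `w`. -/
def HasSquareSuffix (w : List ℕ) : Prop := ∃ u, u ≠ [] ∧ u ++ u <:+ w

/-- Each letter of `w`, read after `c`, is at most the least letter that completes no square: every
smaller letter in its place would be the last letter of a square. -/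
def GreedyAfter (c w : List ℕ) : Prop :=
  ∀ p a s, w = p ++ a :: s → ∀ b < a, HasSquareSuffix (c ++ p ++ [b])

theorem SquareFree.of_infix {v w : List ℕ} (hw : SquareFree w) (h : v <:+: w) : SquareFree v :=
  fun u hu hv => hw u hu (hv.trans h)

theorem HasSquareSuffix.mono {v w : List ℕ} (hv : HasSquareSuffix v) (h : v <:+ w) :
    HasSquareSuffix w := by
  obtain ⟨u, hu, hs⟩ := hv
  exact ⟨u, hu, hs.trans h⟩

theorem hasSquareSuffix_of_eq {w x u : List ℕ} (hu : u ≠ []) (h : w = x ++ (u ++ u)) :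
    HasSquareSuffix w := ⟨u, hu, x, h.symm⟩

namespace GreedyAfter

theorem nil (c : List ℕ) : GreedyAfter c [] := by
  intro p a s h
  simp at h

theorem append {c v w : List ℕ} (hv : GreedyAfter c v) (hw : GreedyAfter (c ++ v) w) :
    GreedyAfter c (v ++ w) := by
  intro p a s h b hb
  rcases List.append_eq_append_iff.1 h with ⟨t, rfl, rfl⟩ | ⟨t, rfl, ht⟩
  · simpa using hw t a s rfl b hb
  · cases t with
    | nil => simpa using hw [] a s (by simpa using ht.symm) b hb
    | cons d t =>
      obtain ⟨rfl, rfl⟩ := List.cons.inj ht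
      exact hv p a t rfl b hb

theorem mono {c w : List ℕ} (h : GreedyAfter c w) (x : List ℕ) : GreedyAfter (x ++ c) w := by
  intro p a s hw b hb
  exact (h p a s hw b hb).mono ⟨x, by simp⟩

theorem left {c v w : List ℕ} (h : GreedyAfter c (v ++ w)) : GreedyAfter c v := by
  intro p a s hv b hb
  exact h p a (s ++ w) (by simp [hv]) b hb

theorem singleton {c : List ℕ} {a : ℕ} (h : ∀ b < a, HasSquareSuffix (c ++ [b])) :
    GreedyAfter c [a] := by
  intro p d s hw b hb
  cases p with
  | nil => simp at hw; obtain ⟨rfl, rfl⟩ := hw; simpa using h b hb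
  | cons e p => simp at hw

theorem last {c w : List ℕ} {a : ℕ} (h : GreedyAfter c (w ++ [a])) :
    ∀ b < a, HasSquareSuffix (c ++ w ++ [b]) :=
  fun b hb => h w a [] rfl b hb

/-- The last letter may be increased when the old one completes a square. -/
theorem succ_last {c w : List ℕ} {a : ℕ} (h : GreedyAfter c (w ++ [a]))
    (hs : HasSquareSuffix (c ++ w ++ [a])) : GreedyAfter c (w ++ [a + 1]) := by
  refine h.left.append (singleton fun b hb => ?_)
  rcases Nat.lt_succ_iff_lt_or_eq.1 hb with hb | rfl
  · exact h.last b hb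
  · exact hs

end GreedyAfter

@[simp] theorem length_prefixOf (x : ℕ → ℕ) (k : ℕ) : (prefixOf x k).length = k := by
  simp [prefixOf]

@[simp] theorem getElem_prefixOf (x : ℕ → ℕ) (k i : ℕ) (h : i < (prefixOf x k).length) :
    (prefixOf x k)[i] = x i := by
  simp [prefixOf]

theorem prefixOf_add (x : ℕ → ℕ) (m n : ℕ) :
    prefixOf x (m + n) = prefixOf x m ++ prefixOf (fun i => x (m + i)) n := by
  simp [prefixOf, List.range_add, Function.comp_def]

theorem prefixOf_prefix (x : ℕ → ℕ) {m n : ℕ} (h : m ≤ n) : prefixOf x m <+: prefixOf x n := by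
  obtain ⟨k, rfl⟩ := Nat.exists_eq_add_of_le h
  exact ⟨_, (prefixOf_add x m k).symm⟩

theorem not_squareFree_prefixOf {x : ℕ → ℕ} {i l n : ℕ} (hl : 0 < l)
    (h : ∀ j < l, x (i + j) = x (i + l + j)) (hn : i + 2 * l ≤ n) :
    ¬ SquareFree (prefixOf x n) := by
  intro hs
  have h2 : prefixOf (fun j => x (i + l + j)) l = prefixOf (fun j => x (i + j)) l :=
    List.map_congr_left fun j hj => (h j (List.mem_range.1 hj)).symm
  refine hs (prefixOf (fun j => x (i + j)) l) ?_
    (List.IsInfix.trans ⟨prefixOf x i, [], ?_⟩ (prefixOf_prefix x hn).isInfix)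
  · rw [← List.length_pos_iff_ne_nil]; simpa using hl
  · rw [List.append_nil, show i + 2 * l = i + l + l by ring, prefixOf_add x (i + l),
      prefixOf_add x i, h2, List.append_assoc]

theorem exists_square_of_hasSquareSuffix {x : ℕ → ℕ} {n : ℕ}
    (h : HasSquareSuffix (prefixOf x n)) :
    ∃ i l, 0 < l ∧ (∀ j < l, x (i + j) = x (i + l + j)) ∧ i + 2 * l = n := by
  obtain ⟨u, hu, v, hv⟩ := h
  have hlen : v.length + (u.length + u.length) = n := by simpa using congrArg List.length hv
  have hx : ∀ k (hk : k < (v ++ (u ++ u)).length), (v ++ (u ++ u))[k] = x k := by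
    intro k hk
    simp [hv]
  refine ⟨v.length, u.length, List.length_pos_iff_ne_nil.2 hu, fun j hj => ?_, by omega⟩
  have h1 : (v ++ (u ++ u))[v.length + j]'(by simp; omega) = u[j] := by
    rw [List.getElem_append_right (by omega), List.getElem_append_left (by omega)]
    simp
  have h2 : (v ++ (u ++ u))[v.length + u.length + j]'(by simp; omega) = u[j] := by
    rw [List.getElem_append_right (by omega), List.getElem_append_right (by omega)]
    congr 1
    omega
  rw [← hx _ (by simp; omega), ← hx _ (by simp; omega), h1, h2]

/-- `L w` is produced letter by letter: since a fresh letter completes no square, a square-free word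
in which each letter after `w` is the least possible one is a prefix of `L w`. -/
theorem prefixOf_L {w v : List ℕ} (hs : SquareFree (w ++ v)) (hg : GreedyAfter w v) :
    prefixOf (L w) (w ++ v).length = w ++ v := by
  obtain ⟨⟨hpre, hsq⟩, hmin⟩ := L_spec w
  simp only [ofLex_toLex] at hpre hsq
  have key : ∀ i (hi : i < (w ++ v).length), L w i = (w ++ v)[i] := by
    intro i
    induction i using Nat.strong_induction_on with
    | _ i ih =>
    intro hi
    by_cases hiw : i < w.length
    · rw [List.getElem_append_left hiw, ← List.getElem_of_eq hpre (by simpa using hiw)]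
      simp
    have htake : prefixOf (L w) i = (w ++ v).take i := by
      apply List.ext_getElem
      · simp; simp at hi; omega
      · intro j h1 h2
        simp only [length_prefixOf] at h1
        simp only [getElem_prefixOf, List.getElem_take]
        exact ih j h1 (by omega)
    rcases lt_trichotomy (L w i) (w ++ v)[i] with hlt | heq | hgt
    · exfalso
      have hiv : i - w.length < v.length := by simp at hi; omega
      have h1 := hg (v.take (i - w.length)) v[i - w.length] (v.drop (i - w.length + 1))
        (by simp) (L w i) (by rwa [List.getElem_append_right (by omega)] at hlt)
      have h2 : w ++ v.take (i - w.length) = (w ++ v).take i := by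
        rw [List.take_append, List.take_of_length_le (by omega : w.length ≤ i)]
      rw [h2, ← htake] at h1
      have h3 : prefixOf (L w) i ++ [L w i] = prefixOf (L w) (i + 1) := by
        rw [prefixOf_add]; simp [prefixOf]
      rw [h3] at h1
      obtain ⟨k, l, hl, hk, hkl⟩ := exists_square_of_hasSquareSuffix h1
      have := hsq k l hl hk
      omega
    · exact heq
    · exfalso
      -- the prefix up to index `i`, followed by fresh letters
      let z : ℕ → ℕ := fun j =>
        if h : j < i + 1 then (w ++ v)[j]'(by omega) else (w ++ v).sum + j + 1
      have hzpre : prefixOf z (i + 1) = (w ++ v).take (i + 1) := by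
        apply List.ext_getElem
        · simp; simp at hi; omega
        · intro j h1 h2
          simp only [length_prefixOf] at h1
          simp [z, Nat.lt_succ_iff.1 h1]
      have hz : SquaresOnlyIn w z := by
        refine ⟨?_, fun k l hl hk => ?_⟩
        · apply List.ext_getElem
          · simp
          · intro j h1 h2
            simp only [getElem_prefixOf, z]
            rw [dif_pos (by omega), List.getElem_append_left h2]
        · exfalso
          by_cases hkl : k + 2 * l ≤ i + 1
          · have hsz : SquareFree (prefixOf z (i + 1)) := by
              rw [hzpre]
              exact hs.of_infix (List.take_prefix _ _).isInfix
            exact not_squareFree_prefixOf hl hk hkl hsz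
          · have h := hk (l - 1) (by omega)
            have h2 : ¬ (k + l + (l - 1) < i + 1) := by omega
            simp only [z, h2, dite_false] at h
            split_ifs at h with h3
            · have := List.le_sum_of_mem
                (List.getElem_mem (show k + (l - 1) < (w ++ v).length by omega))
              omega
            · omega
      have hle : toLex (L w) ≤ toLex z := hmin (show SquaresOnlyIn w (ofLex (toLex z)) from hz)
      refine absurd hle (not_le.2 ⟨i, fun j hj => ?_, ?_⟩)
      · have : z j = L w j := by
          simp only [z]
          rw [dif_pos (by omega), ih j hj (by omega)]
        simpa using this
      · have : z i < L w i := by simpa [z] using hgt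
        simpa using this
  apply List.ext_getElem
  · simp
  · intro i h1 h2
    rw [getElem_prefixOf]
    exact key i h2

/-! ### Squares in a word cut at the occurrences of a letter -/

/-- The word `p₀ m p₁ m ⋯ m pₖ` obtained by writing the letter `m` between the words of a list. -/
def sepJoin (m : ℕ) : List (List ℕ) → List ℕ
  | [] => []
  | [p] => p
  | p :: q :: P => p ++ m :: sepJoin m (q :: P)

theorem sepJoin_append (m : ℕ) (A : List (List ℕ)) (a b : List ℕ) (B : List (List ℕ)) :
    sepJoin m (A ++ [a]) ++ sepJoin m (b :: B) = sepJoin m (A ++ (a ++ b) :: B) := by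
  induction A with
  | nil => cases B <;> simp [sepJoin]
  | cons p A ih => cases A <;> simp_all [sepJoin]

theorem exists_sepJoin (m : ℕ) (w : List ℕ) :
    ∃ b B, w = sepJoin m (b :: B) ∧ ∀ p ∈ b :: B, m ∉ p := by
  induction w with
  | nil => exact ⟨[], [], rfl, by simp⟩
  | cons c w ih =>
    obtain ⟨b, B, rfl, h⟩ := ih
    by_cases hc : c = m
    · exact ⟨[], b :: B, by simp [sepJoin, hc], by simpa using h⟩
    · refine ⟨c :: b, B, ?_, ?_⟩
      · cases B <;> simp [sepJoin]
      · simp only [List.mem_cons, forall_eq_or_imp, not_or] at h ⊢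
        exact ⟨⟨fun h => hc h.symm, h.1⟩, h.2⟩

theorem sepJoin_injective {m : ℕ} {P Q : List (List ℕ)} (hP : ∀ p ∈ P, m ∉ p)
    (hQ : ∀ p ∈ Q, m ∉ p) (hP0 : P ≠ []) (hQ0 : Q ≠ []) (h : sepJoin m P = sepJoin m Q) :
    P = Q := by
  induction P generalizing Q with
  | nil => exact absurd rfl hP0
  | cons p P ih =>
    cases Q with
    | nil => exact absurd rfl hQ0
    | cons q Q =>
      have hp : m ∉ p := hP p (by simp)
      have hq : m ∉ q := hQ q (by simp)
      cases P with
      | nil =>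
        cases Q with
        | nil => simpa [sepJoin] using h
        | cons q' Q =>
          simp only [sepJoin] at h
          exact absurd (h ▸ (by simp : m ∈ q ++ m :: sepJoin m (q' :: Q))) hp
      | cons p' P =>
        cases Q with
        | nil =>
          simp only [sepJoin] at h
          exact absurd (h ▸ (by simp : m ∈ p ++ m :: sepJoin m (p' :: P))) hq
        | cons q' Q =>
          simp only [sepJoin] at h
          have hpq : p = q ∧ sepJoin m (p' :: P) = sepJoin m (q' :: Q) := by
            rcases List.append_eq_append_iff.1 h with ⟨t, rfl, ht⟩ | ⟨t, rfl, ht⟩ <;>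
            · cases t with
              | nil => simpa [eq_comm] using ht
              | cons d t =>
                obtain ⟨rfl, -⟩ := List.cons.inj ht
                simp at hp hq
          rw [hpq.1, ih (fun x hx => hP x (by simp [hx])) (fun x hx => hQ x (by simp [hx]))
            (by simp) (by simp) hpq.2]

theorem exists_sepJoin_concat (m : ℕ) (w : List ℕ) :
    ∃ A a, w = sepJoin m (A ++ [a]) ∧ ∀ p ∈ A ++ [a], m ∉ p := by
  obtain ⟨b, B, h, hm⟩ := exists_sepJoin m w
  obtain ⟨A, a, hA⟩ : ∃ A a, b :: B = A ++ [a] :=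
    ⟨_, _, (List.dropLast_append_getLast (List.cons_ne_nil b B)).symm⟩
  exact ⟨A, a, hA ▸ h, hA ▸ hm⟩

/-- If `u u` with `m` in `u` is a factor of `p₀ m p₁ m ⋯ m pₖ`, where no `pᵢ` contains `m`, then
some piece is a product `t s` of a prefix of a later piece and a suffix of an earlier one, with the
same pieces on both sides of it in between. -/
theorem exists_pieces_of_square {m : ℕ} {P : List (List ℕ)} (hP : ∀ p ∈ P, m ∉ p) (hP0 : P ≠ [])
    {u : List ℕ} (hu : m ∈ u) (h : u ++ u <:+: sepJoin m P) :
    ∃ A a s M t b B, P = A ++ (a ++ s) :: (M ++ (t ++ s) :: (M ++ (t ++ b) :: B)) := by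
  obtain ⟨x, y, hxy⟩ := h
  obtain ⟨A, a, rfl, hA⟩ := exists_sepJoin_concat m x
  obtain ⟨b, B, rfl, hB⟩ := exists_sepJoin m y
  obtain ⟨s, T, rfl, hT⟩ := exists_sepJoin m u
  obtain rfl | ⟨M, t, rfl⟩ : T = [] ∨ ∃ M t, T = M ++ [t] := by
    rcases List.eq_nil_or_concat T with h | ⟨M, t, h⟩
    · exact .inl h
    · exact .inr ⟨M, t, by simpa using h⟩
  · exact absurd hu (hT s (by simp))
  · refine ⟨A, a, s, M, t, b, B, ?_⟩
    have e1 : sepJoin m (s :: (M ++ [t])) ++ sepJoin m (s :: (M ++ [t])) =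
        sepJoin m ((s :: (M ++ (t ++ s) :: M)) ++ [t]) := by
      have := sepJoin_append m (s :: M) t s (M ++ [t])
      simpa using this
    have e2 : sepJoin m (A ++ [a]) ++ sepJoin m ((s :: (M ++ (t ++ s) :: M)) ++ [t]) =
        sepJoin m ((A ++ (a ++ s) :: (M ++ (t ++ s) :: M)) ++ [t]) := by
      have := sepJoin_append m A a s ((M ++ (t ++ s) :: M) ++ [t])
      simpa using this
    rw [e1, e2, sepJoin_append] at hxy
    refine (sepJoin_injective ?_ hP (by simp) hP0 hxy).symm.trans (by simp)
    intro p hp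
    simp only [List.mem_append, List.mem_cons, List.not_mem_nil, or_false] at hp hA hB hT
    rcases hp with (hp | rfl | hp | rfl | hp) | rfl | hp
    · exact hA p (.inl hp)
    · simpa using ⟨hA a (.inr rfl), hT s (.inl rfl)⟩
    · exact hT p (.inr (.inl hp))
    · simpa using ⟨hT t (.inr (.inr rfl)), hT s (.inl rfl)⟩
    · exact hT p (.inr (.inl hp))
    · simpa using ⟨hT t (.inr (.inr rfl)), hB b (.inl rfl)⟩
    · exact hB p (.inr hp)

theorem exists_mem_of_infix_sepJoin {m : ℕ} {P : List (List ℕ)} (hP : ∀ p ∈ P, m ∉ p)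
    (hP0 : P ≠ []) {v : List ℕ} (hv : m ∉ v) (h : v <:+: sepJoin m P) : ∃ p ∈ P, v <:+: p := by
  obtain ⟨x, y, hxy⟩ := h
  obtain ⟨A, a, rfl, hA⟩ := exists_sepJoin_concat m x
  obtain ⟨b, B, rfl, hB⟩ := exists_sepJoin m y
  have e : sepJoin m (A ++ [a]) ++ v = sepJoin m (A ++ [a ++ v]) := sepJoin_append m A a v []
  rw [e, sepJoin_append] at hxy
  have := sepJoin_injective ?_ hP (by simp) hP0 hxy
  · exact ⟨a ++ v ++ b, by simp [← this], a, b, rfl⟩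
  · intro p hp
    simp only [List.mem_append, List.mem_cons, List.not_mem_nil, or_false] at hp hA hB
    rcases hp with hp | rfl | hp
    · exact hA p (.inl hp)
    · simp [hA a (.inr rfl), hv, hB b (.inl rfl)]
    · exact hB p (.inr hp)

theorem squareFree_sepJoin {m : ℕ} {P : List (List ℕ)} (hP : ∀ p ∈ P, m ∉ p) (hP0 : P ≠ [])
    (hs : ∀ p ∈ P, SquareFree p)
    (hno : ∀ A a s M t b B, P ≠ A ++ (a ++ s) :: (M ++ (t ++ s) :: (M ++ (t ++ b) :: B))) :
    SquareFree (sepJoin m P) := by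
  intro u hu h
  by_cases hm : m ∈ u
  · obtain ⟨A, a, s, M, t, b, B, e⟩ := exists_pieces_of_square hP hP0 hm h
    exact hno A a s M t b B e
  · obtain ⟨p, hp, hup⟩ := exists_mem_of_infix_sepJoin hP hP0 (v := u ++ u) (by simpa using hm) h
    exact hs p hp u hu hup

/-! ### The ruler words -/

/-- The word `R n` without its last letter `n`. -/
def rulerCore : ℕ → List ℕ
  | 0 => []
  | n + 1 => rulerCore n ++ n :: rulerCore n

theorem flatMap_rho_rulerCore (n : ℕ) : (rulerCore n).flatMap rho ++ [0] = rulerCore (n + 1) := by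
  induction n with
  | zero => rfl
  | succ n ih =>
    rw [rulerCore, rulerCore, ← ih]
    simp [rho]

theorem R_eq (n : ℕ) : R n = rulerCore n ++ [n] := by
  induction n with
  | zero => rfl
  | succ n ih => rw [R, ih, ← flatMap_rho_rulerCore]; simp [rho]

theorem lt_of_mem_rulerCore {n a : ℕ} (h : a ∈ rulerCore n) : a < n := by
  induction n with
  | zero => simp [rulerCore] at h
  | succ n ih =>
    simp only [rulerCore, List.mem_append, List.mem_cons] at h
    rcases h with h | rfl | h
    · exact (ih h).trans n.lt_succ_self
    · exact a.lt_succ_self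
    · exact (ih h).trans n.lt_succ_self

theorem squareFree_nil : SquareFree [] := by
  intro u hu h
  simp at h
  exact hu h

theorem squareFree_rulerCore (n : ℕ) : SquareFree (rulerCore n) := by
  induction n with
  | zero => exact squareFree_nil
  | succ n ih =>
    refine squareFree_sepJoin (m := n) (P := [rulerCore n, rulerCore n]) ?_ (by simp) ?_ ?_
    · simp only [List.mem_cons, List.not_mem_nil, or_false, or_self, forall_eq]
      exact fun h => lt_irrefl _ (lt_of_mem_rulerCore h)
    · simpa using ih
    · intro A a s M t b B h
      have := congrArg List.length h
      simp at this
      omega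

theorem squareFree_R (n : ℕ) : SquareFree (R n) :=
  (squareFree_rulerCore (n + 1)).of_infix
    (List.IsPrefix.isInfix ⟨rulerCore n, by rw [R_eq, rulerCore]; simp⟩)

theorem greedyAfter_nil_R (n : ℕ) : GreedyAfter [] (R n) := by
  induction n with
  | zero => exact GreedyAfter.singleton fun b hb => absurd hb (Nat.not_lt_zero b)
  | succ n ih =>
    have e : R (n + 1) = R n ++ (rulerCore n ++ [n + 1]) := by simp [R_eq, rulerCore]
    rw [e]
    refine ih.append (GreedyAfter.succ_last ?_ ?_)
    · rw [← R_eq]; simpa using ih.mono (R n)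
    · exact hasSquareSuffix_of_eq (x := []) (u := R n) (by simp [R_eq]) (by simp [R_eq])

theorem prefixOf_L_nil (n : ℕ) : prefixOf (L []) (2 ^ n) = R n := by
  have := prefixOf_L (w := []) (v := R n) (squareFree_R n) (greedyAfter_nil_R n)
  simpa [length_R] using this

theorem L_nil : L [] = ruler := by
  funext i
  have h : i < (R i).length := by rw [length_R]; exact Nat.lt_two_pow_self
  rw [ruler, ← List.getElem_of_eq (prefixOf_L_nil i) (by simpa using Nat.lt_two_pow_self)]
  simp

theorem prefixOf_ruler (n : ℕ) : prefixOf ruler (2 ^ n) = R n := by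
  rw [← L_nil, prefixOf_L_nil]

/-! ### Verification of squares and of greediness by arithmetic

A word is encoded as a numeral whose least significant digit is its last letter, so that the kernel
compares long factors by a few operations on large numbers. -/

/-- The numeral in base `B` with digits `f a` for the letters `a` of a word, written after the
numeral `v`. Both branches agree: the test only makes the kernel evaluate `v` at each step. -/
def numeral (B : ℕ) (f : ℕ → ℕ) : List ℕ → ℕ → ℕ
  | [], v => v
  | a :: w, v => bif Nat.beq v 0 then numeral B f w (Nat.add (Nat.mul B v) (f a))
      else numeral B f w (Nat.add (Nat.mul B v) (f a))

theorem numeral_cons (B : ℕ) (f : ℕ → ℕ) (a : ℕ) (w : List ℕ) (v : ℕ) :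
    numeral B f (a :: w) v = numeral B f w (B * v + f a) := by
  rw [numeral, Bool.cond_self]
  rfl

theorem numeral_eq (B : ℕ) (f : ℕ → ℕ) (w : List ℕ) (v : ℕ) :
    numeral B f w v = B ^ w.length * v + numeral B f w 0 := by
  induction w generalizing v with
  | nil => simp [numeral]
  | cons a w ih =>
    rw [numeral_cons, numeral_cons, ih, ih (B * 0 + f a), List.length_cons, pow_succ]
    ring

theorem numeral_append (B : ℕ) (f : ℕ → ℕ) (u w : List ℕ) :
    numeral B f (u ++ w) 0 = B ^ w.length * numeral B f u 0 + numeral B f w 0 := by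
  have h : ∀ v, numeral B f (u ++ w) v = numeral B f w (numeral B f u v) := by
    induction u with
    | nil => intro v; rfl
    | cons a u ih => intro v; rw [List.cons_append, numeral_cons, numeral_cons, ih]
  rw [h, numeral_eq]

theorem numeral_singleton (B : ℕ) (f : ℕ → ℕ) (a : ℕ) : numeral B f [a] 0 = f a := by
  simp [numeral]

theorem numeral_lt {B : ℕ} {f : ℕ → ℕ} {w : List ℕ} (h : ∀ a ∈ w, f a < B) :
    numeral B f w 0 < B ^ w.length := by
  induction w with
  | nil => simp [numeral]
  | cons a w ih =>
    have h1 := ih fun b hb => h b (by simp [hb])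
    have h2 : f a + 1 ≤ B := h a (by simp)
    rw [numeral_cons, numeral_eq, List.length_cons, pow_succ]
    nlinarith [Nat.mul_le_mul_left (B ^ w.length) h2]

theorem numeral_injective {B : ℕ} {u w : List ℕ} (hl : u.length = w.length)
    (hu : ∀ a ∈ u, a < B) (hw : ∀ a ∈ w, a < B) (h : numeral B id u 0 = numeral B id w 0) :
    u = w := by
  induction u generalizing w with
  | nil => exact (List.length_eq_zero_iff.1 hl.symm).symm
  | cons a u ih =>
    cases w with
    | nil => simp at hl
    | cons b w =>
      have hl' : u.length = w.length := by simpa using hl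
      have h1 : numeral B id u 0 < B ^ w.length :=
        hl' ▸ numeral_lt fun c hc => hu c (by simp [hc])
      have h2 : numeral B id w 0 < B ^ w.length := numeral_lt fun c hc => hw c (by simp [hc])
      rw [numeral_cons, numeral_cons, numeral_eq, numeral_eq B id w, hl'] at h
      simp only [mul_zero, zero_add, id] at h
      have hB : 0 < B ^ w.length := by omega
      have ha : a = b := by
        have := congrArg (· / B ^ w.length) h
        simpa [Nat.mul_add_div hB, Nat.div_eq_of_lt h1, Nat.div_eq_of_lt h2] using this
      subst ha
      rw [ih hl' (fun c hc => hu c (by simp [hc])) (fun c hc => hw c (by simp [hc])) (by omega)]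

/-- Whether a word with numeral `v` in base 8 and length `n` ends in a square of some period in
`ls`. -/
def endsInSquare (v n : ℕ) : List ℕ → Bool
  | [] => false
  | l :: ls => bif Nat.ble (Nat.mul 2 l) n then
      bif Nat.beq (Nat.mod v (Nat.pow 8 l)) (Nat.mod (Nat.div v (Nat.pow 8 l)) (Nat.pow 8 l))
      then true else endsInSquare v n ls
    else endsInSquare v n ls

/-- Whether each letter below `a` completes a square after the word with numeral `v` and length
`n`. -/
def letterIsGreedy (ls : List ℕ) (v n : ℕ) : ℕ → Bool
  | 0 => true
  | a + 1 => bif endsInSquare (Nat.add (Nat.mul 8 v) a) (Nat.succ n) ls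
      then letterIsGreedy ls v n a else false

/-- Whether a word is greedy after the word with numeral `v` and length `n`, the squares being
looked for among the periods in `ls`. -/
def wordIsGreedy (ls : List ℕ) : List ℕ → ℕ → ℕ → Bool
  | [], _, _ => true
  | a :: w, v, n => bif letterIsGreedy ls v n a
      then wordIsGreedy ls w (Nat.add (Nat.mul 8 v) a) (Nat.succ n) else false

theorem hasSquareSuffix_of_endsInSquare {ls w : List ℕ} (hls : ∀ l ∈ ls, 0 < l)
    (hw : ∀ a ∈ w, a < 8) (h : endsInSquare (numeral 8 id w 0) w.length ls = true) :
    HasSquareSuffix w := by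
  induction ls with
  | nil => simp [endsInSquare] at h
  | cons l ls ih =>
    have ih := ih fun k hk => hls k (by simp [hk])
    rw [endsInSquare] at h
    by_cases h1 : Nat.ble (Nat.mul 2 l) w.length = true
    swap
    · exact ih (by rwa [Bool.eq_false_iff.2 h1, cond_false] at h)
    rw [h1, cond_true] at h
    by_cases h2 : Nat.beq (Nat.mod (numeral 8 id w 0) (Nat.pow 8 l))
        (Nat.mod (Nat.div (numeral 8 id w 0) (Nat.pow 8 l)) (Nat.pow 8 l)) = true
    swap
    · exact ih (by rwa [Bool.eq_false_iff.2 h2, cond_false] at h)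
    have hl : 0 < l := hls l (by simp)
    have h1 : 2 * l ≤ w.length := Nat.le_of_ble_eq_true h1
    have h2 : numeral 8 id w 0 % 8 ^ l = numeral 8 id w 0 / 8 ^ l % 8 ^ l :=
      Nat.eq_of_beq_eq_true h2
    obtain ⟨x, p, q, rfl, hp, hq⟩ : ∃ x p q, w = x ++ (p ++ q) ∧ p.length = l ∧ q.length = l := by
      refine ⟨w.take (w.length - 2 * l), (w.drop (w.length - 2 * l)).take l,
        (w.drop (w.length - 2 * l)).drop l, by simp only [List.take_append_drop], ?_, ?_⟩
      · simp; omega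
      · simp; omega
    have hp8 : ∀ a ∈ p, a < 8 := fun a ha => hw a (by simp [ha])
    have hq8 : ∀ a ∈ q, a < 8 := fun a ha => hw a (by simp [ha])
    have hpl : numeral 8 id p 0 < 8 ^ l := hp ▸ numeral_lt hp8
    have hql : numeral 8 id q 0 < 8 ^ l := hq ▸ numeral_lt hq8
    rw [numeral_append, numeral_append, List.length_append, hp, hq, pow_add] at h2
    have e : 8 ^ l * 8 ^ l * numeral 8 id x 0 + (8 ^ l * numeral 8 id p 0 + numeral 8 id q 0) =
        8 ^ l * (8 ^ l * numeral 8 id x 0 + numeral 8 id p 0) + numeral 8 id q 0 := by ring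
    rw [e, Nat.mul_add_mod, Nat.mul_add_div (by positivity), Nat.mod_eq_of_lt hql,
      Nat.div_eq_of_lt hql, add_zero, Nat.mul_add_mod, Nat.mod_eq_of_lt hpl] at h2
    obtain rfl := numeral_injective (hq.trans hp.symm) hq8 hp8 h2
    exact ⟨q, List.length_pos_iff_ne_nil.1 (hq ▸ hl), x, rfl⟩

theorem greedyAfter_of_wordIsGreedy {ls c w : List ℕ} (hls : ∀ l ∈ ls, 0 < l)
    (hc : ∀ a ∈ c, a < 8) (hw : ∀ a ∈ w, a < 8)
    (h : wordIsGreedy ls w (numeral 8 id c 0) c.length = true) : GreedyAfter c w := by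
  induction w generalizing c with
  | nil => exact GreedyAfter.nil c
  | cons a w ih =>
    have happ : ∀ b, numeral 8 id (c ++ [b]) 0 = 8 * numeral 8 id c 0 + b := by
      intro b
      rw [numeral_append, numeral_singleton]
      simp
    have hc' : ∀ b < 8, ∀ d ∈ c ++ [b], d < 8 := by
      intro b hb d hd
      rcases List.mem_append.1 hd with hd | hd
      · exact hc d hd
      · rw [List.mem_singleton.1 hd]; exact hb
    have ha : a < 8 := hw a (by simp)
    rw [wordIsGreedy] at h
    by_cases h1 : letterIsGreedy ls (numeral 8 id c 0) c.length a = true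
    swap
    · rw [Bool.eq_false_iff.2 h1] at h
      exact absurd h Bool.false_ne_true
    rw [h1, cond_true] at h
    refine GreedyAfter.append (v := [a]) (GreedyAfter.singleton ?_) (ih (hc' a ha)
      (fun b hb => hw b (by simp [hb])) ?_)
    · have key : ∀ k ≤ a, letterIsGreedy ls (numeral 8 id c 0) c.length k = true →
          ∀ b < k, HasSquareSuffix (c ++ [b]) := by
        intro k
        induction k with
        | zero => intro _ _ b hb; exact absurd hb (Nat.not_lt_zero b)
        | succ k ihk =>
          intro hk h b hb
          rw [letterIsGreedy] at h
          by_cases h2 : endsInSquare (Nat.add (Nat.mul 8 (numeral 8 id c 0)) k)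
              (Nat.succ c.length) ls = true
          · rw [h2, cond_true] at h
            rcases Nat.lt_succ_iff_lt_or_eq.1 hb with hb | rfl
            · exact ihk (by omega) h b hb
            · refine hasSquareSuffix_of_endsInSquare hls (hc' b (by omega)) ?_
              rw [happ, List.length_append]
              exact h2
          · rw [Bool.eq_false_iff.2 h2] at h
            exact absurd h Bool.false_ne_true
      exact key a le_rfl h1
    · rw [happ, List.length_append]
      exact h

/-- Given a binary numeral `F` each bit of which is the disjunction of the `w` bits of a number
from that place on, the numeral of the disjunctions of `l` bits, by doubling `w` at most `k`
times. -/
def windowOr (l : ℕ) : ℕ → ℕ → ℕ → ℕ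
  | 0, F, _ => F
  | k + 1, F, w => bif Nat.ble (Nat.mul 2 w) l
      then windowOr l k (Nat.lor F (Nat.shiftRight F w)) (Nat.mul 2 w)
      else Nat.lor F (Nat.shiftRight F (Nat.sub l w))

/-- Whether words of length `N` whose letters have the binary digits recorded in `p`, `q` and `r`
have no square of period `l`: the bits of the disjunction of exclusive ors mark the places where a
letter differs from the one `l` places before it, and each `l` consecutive places must contain a
mark. -/
def noSquareOfPeriod (p q r N l : ℕ) : Bool :=
  Nat.beq (Nat.mod (Nat.succ (windowOr l 20 (Nat.lor (Nat.xor p (Nat.shiftRight p l))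
    (Nat.lor (Nat.xor q (Nat.shiftRight q l)) (Nat.xor r (Nat.shiftRight r l)))) 1))
    (Nat.pow 2 (Nat.succ (Nat.sub N (Nat.mul 2 l))))) 0

def noSquareOfPeriods (p q r N s : ℕ) : ℕ → Bool
  | 0 => true
  | n + 1 => bif noSquareOfPeriod p q r N (Nat.add s n) then noSquareOfPeriods p q r N s n
      else false

/-- The binary digit of weight `2 ^ k` of a letter. -/
def letterBit (k a : ℕ) : ℕ := Nat.mod (Nat.div a (Nat.pow 2 k)) 2

/-- Whether the word `w` of length `N` has no square with a period in `s, …, s + n - 1`. -/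
def hasNoSquare (w : List ℕ) (N s n : ℕ) : Bool :=
  noSquareOfPeriods (numeral 2 (letterBit 0) w 0) (numeral 2 (letterBit 1) w 0)
    (numeral 2 (letterBit 2) w 0) N s n

theorem testBit_windowOr {D : ℕ} (l k F w i : ℕ) (hw : w ≤ l)
    (hF : ∀ i, (∀ j < w, D.testBit (i + j) = false) → F.testBit i = false)
    (hD : ∀ j < l, D.testBit (i + j) = false) : (windowOr l k F w).testBit i = false := by
  induction k generalizing F w with
  | zero => exact hF i fun j hj => hD j (by omega)
  | succ k ih =>
    rw [windowOr]
    by_cases h : Nat.ble (Nat.mul 2 w) l = true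
    · have h2 : 2 * w ≤ l := Nat.le_of_ble_eq_true h
      rw [h, cond_true]
      refine ih _ _ h2 fun i hi => ?_
      change (F ||| F >>> w).testBit i = false
      have hi : ∀ j < 2 * w, D.testBit (i + j) = false := hi
      rw [Nat.testBit_or, Nat.testBit_shiftRight, hF i fun j hj => hi j (by omega),
        hF (w + i) fun j hj => by rw [show w + i + j = i + (w + j) by ring]; exact hi _ (by omega)]
      rfl
    · rw [Bool.eq_false_iff.2 h, cond_false]
      change (F ||| F >>> (l - w)).testBit i = false
      rw [Nat.testBit_or, Nat.testBit_shiftRight, hF i fun j hj => hD j (by omega),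
        hF (l - w + i) fun j hj => by
          rw [show l - w + i + j = i + (l - w + j) by ring]; exact hD _ (by omega)]
      rfl

theorem testBit_numeral {f : ℕ → ℕ} (hf : ∀ a, f a < 2) (x y : List ℕ) (a : ℕ) :
    (numeral 2 f (x ++ a :: y) 0).testBit y.length = decide (f a = 1) := by
  have h : numeral 2 f y 0 < 2 ^ y.length := numeral_lt fun a _ => hf a
  rw [← List.singleton_append, ← List.append_assoc, numeral_append, numeral_append,
    numeral_singleton, Nat.testBit_two_pow_mul_add _ h]
  simp
  have := hf a
  interval_cases f a <;> simp

theorem testBit_xor_numeral {f : ℕ → ℕ} (hf : ∀ a, f a < 2) (x u y : List ℕ) (j : ℕ)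
    (hj : j < u.length) :
    (Nat.xor (numeral 2 f (x ++ (u ++ u) ++ y) 0)
      (Nat.shiftRight (numeral 2 f (x ++ (u ++ u) ++ y) 0) u.length)).testBit (y.length + j) =
      false := by
  obtain ⟨v, a, t, rfl, rfl⟩ : ∃ v a t, u = v ++ a :: t ∧ t.length = j := by
    refine ⟨u.take (u.length - 1 - j), u[u.length - 1 - j], u.drop (u.length - 1 - j + 1),
      by simp, ?_⟩
    simp; omega
  change Nat.testBit (_ ^^^ _ >>> _) _ = false
  rw [Nat.testBit_xor, Nat.testBit_shiftRight]
  have h1 := testBit_numeral hf (x ++ (v ++ a :: t) ++ v) (t ++ y) a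
  have h2 := testBit_numeral hf (x ++ v) (t ++ (v ++ a :: t) ++ y) a
  have e1 : x ++ (v ++ a :: t) ++ v ++ a :: (t ++ y) =
      x ++ (v ++ a :: t ++ (v ++ a :: t)) ++ y := by simp
  have e2 : x ++ v ++ a :: (t ++ (v ++ a :: t) ++ y) =
      x ++ (v ++ a :: t ++ (v ++ a :: t)) ++ y := by simp
  rw [e1] at h1
  rw [e2] at h2
  have l1 : y.length + t.length = (t ++ y).length := by simp [add_comm]
  have l2 : (v ++ a :: t).length + (y.length + t.length) =
      (t ++ (v ++ a :: t) ++ y).length := by simp; ring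
  rw [l2, h2, l1, h1, Bool.xor_self]

theorem not_square_of_noSquareOfPeriod {w u : List ℕ} (hu : u ≠ [])
    (h : noSquareOfPeriod (numeral 2 (letterBit 0) w 0) (numeral 2 (letterBit 1) w 0)
      (numeral 2 (letterBit 2) w 0) w.length u.length = true) : ¬ u ++ u <:+: w := by
  rintro ⟨x, y, rfl⟩
  have hf : ∀ k a, letterBit k a < 2 := fun k a => Nat.mod_lt _ (by norm_num)
  have hor : ∀ {a b i : ℕ}, a.testBit i = false → b.testBit i = false →
      (Nat.lor a b).testBit i = false := by
    intro a b i ha hb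
    change (a ||| b).testBit i = false
    rw [Nat.testBit_or, ha, hb]
    rfl
  have h0 : 1 ≤ u.length := List.length_pos_iff_ne_nil.2 hu
  have h := Nat.eq_of_beq_eq_true h
  have hwin (D : ℕ) := testBit_windowOr (D := D) u.length 20 D 1 y.length h0
    fun i hi => hi 0 one_pos
  replace hwin := hwin (Nat.lor _ (Nat.lor _ _)) fun j hj =>
    hor (testBit_xor_numeral (hf 0) x u y j hj)
      (hor (testBit_xor_numeral (hf 1) x u y j hj) (testBit_xor_numeral (hf 2) x u y j hj))
  revert h hwin
  generalize windowOr _ _ _ _ = F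
  intro h hwin
  have h : (F + 1) % 2 ^ ((x ++ (u ++ u) ++ y).length - 2 * u.length + 1) = 0 := h
  obtain ⟨M, hM⟩ : ∃ M, M = (x ++ (u ++ u) ++ y).length - 2 * u.length + 1 := ⟨_, rfl⟩
  rw [← hM] at h
  have hy : y.length < M := by rw [hM]; simp; omega
  have hF : F % 2 ^ M = 2 ^ M - 1 := by
    have hpos : 0 < 2 ^ M := by positivity
    have hlt := Nat.mod_lt F hpos
    rw [Nat.add_mod] at h
    rcases Nat.lt_or_ge (F % 2 ^ M + 1) (2 ^ M) with h3 | h3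
    · rcases Nat.lt_or_ge 1 (2 ^ M) with h4 | h4
      · rw [Nat.mod_eq_of_lt h4, Nat.mod_eq_of_lt h3] at h
        omega
      · omega
    · omega
  have h1 := Nat.testBit_mod_two_pow F M y.length
  rw [hF, Nat.testBit_two_pow_sub_one, hwin] at h1
  simp [hy] at h1

theorem not_square_of_hasNoSquare {w u : List ℕ} {N s n : ℕ} (hN : w.length = N)
    (h : hasNoSquare w N s n = true) (hu : u ≠ []) (h1 : s ≤ u.length) (h2 : u.length < s + n) :
    ¬ u ++ u <:+: w := by
  subst hN
  rw [hasNoSquare] at h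
  induction n with
  | zero => omega
  | succ n ih =>
    rw [noSquareOfPeriods] at h
    by_cases h3 : noSquareOfPeriod (numeral 2 (letterBit 0) w 0) (numeral 2 (letterBit 1) w 0)
        (numeral 2 (letterBit 2) w 0) w.length (Nat.add s n) = true
    · rw [h3, cond_true] at h
      by_cases h4 : u.length = s + n
      · exact not_square_of_noSquareOfPeriod hu (h4 ▸ h3)
      · exact ih (by omega) h
    · rw [Bool.eq_false_iff.2 h3] at h
      exact absurd h Bool.false_ne_true

/-! ### The constant words and the verifications about them -/

/-- The word of the last `k` decimal digits of a numeral. -/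
def digitWord : ℕ → ℕ → List ℕ
  | 0, _ => []
  | k + 1, n => (n / 10 ^ k % 10) :: digitWord k n

/-- The word `Y1`, whose letters are decimal digits. -/
def Y1Digits : List ℕ :=
  List.flatMap (digitWord 92)
   [10120102012021012010201203010201030102030103020102030102010301020301030201202101201020120210,
   12023010201030102012021012010201202101301020103010201202101201020120210201021012010201202101,
   20102013010201030102012021012010201202101301020103010201202101201020120230102010301020120210,
   12010201203010201030102030103020102030102010301020301030201202101201020120210120230102010301,
   02012021012010201202101301020103010201202101201020120210201021012010201202101201020130102010,
   30102012021012010201202101301020103010201202101201020120230102010401020103010201040102012021,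
   01201020120210130102010301020120210120102012021013010201040102010301020104010201202101201020,
   12021013010201030102012021012010201202102010210120102012021012010201301020103010201202101201,
   02012021013010201030102012021012010201202301020103010201202101201020120301020103010203010302,
   01020301020103010203010302012021012010201202101202301020103010201202101201020120210130102010,
   30102012021012010201202102010210120102012021012010201301020103010201202101201020120210130102,
   01030102012021012010201202301020103010201202101201020120301020103010203010302010203010201030,
   10203010302012021012010201202101202301020104010201030102010401020120210120102012021013010201,
   03010201202101201020120210130102010401020103010201040102012021012010201202101301020103010201,
   20210120102012021020102101201020120210120102013010201030102012021012010201202101301020103010,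
   20120210120102012023010201030102012021012010201203010201030102030103020102030102010301020301,
   03020120210120102012021012023010201030102012021012010201202101301020103010201202101201020120,
   21020102101201020120210120102013010201030102012021012010201202101301020103010201202101201020,
   12023010201030102012021012010201203010201030102030103020102030102010301020301030201202101201,
   02012023010201030102012021012010201202101301020103010201202101201020120210201021012010201202,
   10120102013010201030102012021012010201202101301020103010201202101201020120230102010301020120,
   21012010201203010201030102030103020102030102010301020301030201202101201030102010301201020120,
   21012010201202301020103010201202101201020120210130102010301020120210120102012021020102101201,
   02012021012010201301020103010201202101201020120210130102010301020120210120102012023010201030,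
   10201202101201020120301020103010203010302010203010201030102030103020120210120102012021012023,
   01020103010201202101201020120210130102010301020120210120102012021020102101201020120210120102,
   01301020103010201202101201020120210130102010301020120210120102012023010201030102012021012010,
   20120301020103010203010302010203010201030102030103020120210120102012023010201030102012021012,
   01020120210130102010301020120210120102012021020102101201020120210120102013010201030102012021,
   01201020120210130102010301020120210120102012023010201030102012021012010201203010201030102030,
   10302010203010201030102030103020120210120103010201030120102012021012010201202301020104010201,
   03010201040102012021012010201202101301020103010201202101201020120210130102010401020103010201,
   04010201202101201020120210130102010301020120210120102012021020102101201020120210120102013010,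
   20103010201202101201020120210130102010301020120210120102012023010201030102012021012010201203,
   01020103010203010302010203010201030102030103020120210120102012021012023010201030102012021012,
   01020120210130102010301020120210120102012021020102101201020120210120102013010201030102012021,
   01201020120210130102010301020120210120102012023010201030102012021012010201203010201030102030,
   10302010203010201030102030103020120210120102012021012023010201040102010301020104010201202101,
   20102012021013010201030102012021012010201202101301020104010201030102010401020120210120102012,
   02101301020103010201202101201020120210201021012010201202101201020130102010301020120210120102,
   01202101301020103010201202101201020120230102010301020120210120102012030102010301020301030201,
   02030102010301020301030201202101201020120210120230102010301020120210120102012021013010201030,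
   10201202101201020120210201021012010201202101201020130102010301020120210120102012021013010201,
   03010201202101201020120230102010301020120210120102012030102010301020301030201020301020103010,
   20301030201202101201020120230102010301020120210120102012021013010201030102012021012010201202,
   10201021012010201202101201020130102010301020120210120102012021013010201030102012021012010201,
   20230102010301020120210120102012030102010301020301030201020301020103010203010302012021012010,
   30102010301201020120210120102012023010201030102012021012010201202101301020103010201202101201,
   02012021020102101201020120210120102013010201030102012021012010201202101301020103010201202101,
   20102012023010201030102012021012010201203010201030102030103020102030102010301020301030201202,
   10120102012021012023010201030102012021012010201202101301020103010201202101201020120210201021,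
   01201020120210120102013010201030102012021012010201202101301020103010201202101201020120230102,
   01030102012021012010201203010201030102030103020102030102010301020301030201202101201020120230,
   10201030102012021012010201202101301020103010201202101201020120210201021012010201202101201020,
   13010201030102012021012010201202101301020103010201202101201020120230102010301020120210120102,
   01203010201030102030103020102030102010301020301030201202101201030102010301302010203010201030] ++
    digitWord 25 1020301030201020301020103

/-- The word `B0`, whose letters are decimal digits. -/
def B0Digits : List ℕ :=
  List.flatMap (digitWord 92)
   [03012010201202101201020120230102010301020120210120102012021013010201030102012021012010201202,
   10201021012010201202101201020130102010301020120210120102012021013010201030102012021012010201,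
   20230102010301020120210120102012030102010301020301030201020301020103010203010302012021012010,
   20120210120230102010301020120210120102012021013010201030102012021012010201202102010210120102,
   01202101201020130102010301020120210120102012021013010201030102012021012010201202301020103010,
   20120210120102012030102010301020301030201020301020103010203010302012021012010201202301020103,
   01020120210120102012021013010201030102012021012010201202102010210120102012021012010201301020,
   10301020120210120102012021013010201030102012021012010201202301020103010201202101201020120301] ++
    digitWord 62 02010301020301030201020301020103010203010302012021012010301020

/-- The word `B1`, computed from the digits of `B0`. -/
def B1Digits : List ℕ := ((B0Digits.drop 7).rdrop 5).flatMap rho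

/-- The word `α(0)`, computed from the digits of `B0`. -/
def alphaZeroDigits : List ℕ :=
  ([0, 1, 0, 2] ++ B0Digits ++ [1] ++ B0Digits.rdrop 9) ++
    (B0Digits.rtake 9 ++ [3, 0, 1, 0, 3, 0, 2] ++ C ++ [0, 1, 0, 3] ++ succWord C ++ [0, 2]) ++
    ([0, 1, 0, 2] ++ B0Digits ++ [1] ++ B0Digits.rdrop 9)

/-- The word `α(1)` without its last letter. -/
def alphaOneCore : List ℕ := B1Digits ++ R 4 ++ C ++ B1Digits ++ rulerCore 4

/-- The prefix of `Y1 α(0) α(1) α(0) α(1)` that lacks the last letter. It is the start of the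
induction that proves square-freeness. -/
def startWord : List ℕ := Y1Digits ++ alphaZeroDigits ++ alphaOneCore ++ [4] ++ alphaZeroDigits ++
  alphaOneCore

theorem length_digitWord (k n : ℕ) : (digitWord k n).length = k := by
  induction k with
  | zero => rfl
  | succ k ih => simp [digitWord, ih]

theorem length_Y1Digits : Y1Digits.length = 5177 := by
  simp [Y1Digits, length_digitWord]

theorem length_B0Digits : B0Digits.length = 798 := by
  simp [B0Digits, length_digitWord]

theorem length_flatMap_rho (w : List ℕ) : (w.flatMap rho).length = 2 * w.length := by
  induction w with
  | nil => rfl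
  | cons a w ih =>
    rw [List.flatMap_cons, List.length_append, ih, List.length_cons]
    simp [rho]
    ring

theorem length_B1Digits : B1Digits.length = 1572 := by
  rw [B1Digits, length_flatMap_rho, List.rdrop, List.length_take, List.length_drop,
    length_B0Digits]
  rfl

theorem length_alphaZeroDigits : alphaZeroDigits.length = 3226 := by
  simp only [alphaZeroDigits, List.rdrop, List.rtake, List.length_append, List.length_take,
    List.length_drop, length_B0Digits]
  rfl

theorem length_alphaOneCore : alphaOneCore.length = 3185 := by
  simp only [alphaOneCore, List.length_append, length_B1Digits, length_R]
  rfl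

theorem length_startWord : startWord.length = 18000 := by
  simp [startWord, length_Y1Digits, length_alphaZeroDigits, length_alphaOneCore]

set_option maxRecDepth 100000 in
theorem hasNoSquare_startWord_small : hasNoSquare startWord 18000 1 3000 = true := by
  decide +kernel

set_option maxRecDepth 100000 in
theorem hasNoSquare_startWord_medium : hasNoSquare startWord 18000 3000 3000 = true := by
  decide +kernel

set_option maxRecDepth 100000 in
theorem hasNoSquare_startWord_large : hasNoSquare startWord 18000 6000 3001 = true := by
  decide +kernel

theorem squareFree_startWord : SquareFree startWord := by
  intro u hu h
  have hlen := h.length_le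
  rw [length_startWord, List.length_append] at hlen
  have hpos := List.length_pos_iff_ne_nil.2 hu
  rcases lt_or_ge u.length 3000 with h1 | h1
  · exact not_square_of_hasNoSquare length_startWord hasNoSquare_startWord_small hu hpos
      (by omega) h
  · rcases lt_or_ge u.length 6000 with h2 | h2
    · exact not_square_of_hasNoSquare length_startWord hasNoSquare_startWord_medium hu h1
        (by omega) h
    · exact not_square_of_hasNoSquare length_startWord hasNoSquare_startWord_large hu h2
        (by omega) h

set_option maxRecDepth 100000 in
theorem squareFree_C_append_alphaOneCore : SquareFree (C ++ alphaOneCore) := by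
  intro u hu h
  have hN : (C ++ alphaOneCore).length = 3195 := by simp [length_alphaOneCore, C]
  have hlen := h.length_le
  rw [hN, List.length_append] at hlen
  have hpos := List.length_pos_iff_ne_nil.2 hu
  exact not_square_of_hasNoSquare (s := 1) (n := 1600) hN (by decide +kernel) hu hpos (by omega) h

/-- The periods of the squares that make the verified words greedy. -/
def periods : List ℕ :=
  [1, 2, 4, 8, 6, 3, 16, 13, 26, 31, 34, 68, 12, 62, 52, 84, 255, 261, 510, 522, 622, 799, 1634,
    2320]

theorem greedyAfter_of_periods {c w : List ℕ} (h8 : (c ++ w).all (fun a => Nat.blt a 8) = true)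
    (h : wordIsGreedy periods w (numeral 8 id c 0) c.length = true) : GreedyAfter c w := by
  have h8 : ∀ a ∈ c ++ w, a < 8 := fun a ha => Nat.le_of_ble_eq_true (List.all_eq_true.1 h8 a ha)
  refine greedyAfter_of_wordIsGreedy (by decide) (fun a ha => h8 a (by simp [ha]))
    (fun a ha => h8 a (by simp [ha])) h

set_option maxRecDepth 100000 in
theorem greedyAfter_one_Y1Digits : GreedyAfter [1] Y1Digits.tail :=
  greedyAfter_of_periods (by decide +kernel) (by decide +kernel)

set_option maxRecDepth 100000 in
theorem greedyAfter_Y1Digits_take : GreedyAfter Y1Digits (alphaZeroDigits.take 9) :=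
  greedyAfter_of_periods (by decide +kernel) (by decide +kernel)

set_option maxRecDepth 100000 in
theorem greedyAfter_take_drop :
    GreedyAfter (alphaZeroDigits.take 9) (alphaZeroDigits.drop 9) :=
  greedyAfter_of_periods (by decide +kernel) (by decide +kernel)

set_option maxRecDepth 100000 in
theorem greedyAfter_alphaZeroDigits_B1Digits : GreedyAfter alphaZeroDigits B1Digits :=
  greedyAfter_of_periods (by decide +kernel) (by decide +kernel)

set_option maxRecDepth 100000 in
theorem greedyAfter_C_B1Digits : GreedyAfter C B1Digits :=
  greedyAfter_of_periods (by decide +kernel) (by decide +kernel)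

/-! ### Evaluation of the constant words -/

theorem P0_eq {n k : ℕ} {v : List ℕ} (hs : SquareFree ([n] ++ v)) (hg : GreedyAfter [n] v)
    (hlen : v.length = k + 1) (h1 : prefixOf ruler k = v.take k)
    (h2 : prefixOf ruler (k + 1) ≠ v) : P0 n = v.take k := by
  have hL : prefixOf (L [n]) (k + 2) = n :: v := by
    have := prefixOf_L hs hg
    simpa [hlen] using this
  have hle : ∀ j ≤ k + 1, prefixOf (L [n]) (j + 1) = n :: v.take j := by
    intro j hj
    have h := prefixOf_prefix (L [n]) (show j + 1 ≤ k + 2 by omega)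
    rw [hL, List.prefix_iff_eq_take, length_prefixOf, List.take_succ_cons] at h
    exact h
  rw [P0, ← h1]
  congr 1
  refine IsGreatest.csSup_eq ⟨?_, fun j hj => ?_⟩
  · rw [Set.mem_ofPred_eq, hle k (by omega), h1]
  · by_contra hlt
    have hj : prefixOf (L [n]) (j + 1) = n :: prefixOf ruler j := hj
    have h3 := prefixOf_prefix (L [n]) (show k + 2 ≤ j + 1 by omega)
    have h4 := prefixOf_prefix ruler (show k + 1 ≤ j by omega)
    rw [hL, hj, List.cons_prefix_cons] at h3
    exact h2 (List.IsPrefix.eq_of_length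
      (List.prefix_of_prefix_length_le h4 h3.2 (by simp [hlen])) (by simp [hlen]))

theorem prefixOf_ruler_le {k n : ℕ} (h : k ≤ 2 ^ n) : prefixOf ruler k = (R n).take k := by
  have := prefixOf_prefix ruler h
  rw [prefixOf_ruler, List.prefix_iff_eq_take] at this
  simpa using this

theorem squareFree_of_hasNoSquare {w : List ℕ} (h : hasNoSquare w w.length 1 w.length = true) :
    SquareFree w := by
  intro u hu hw
  have hlen := hw.length_le
  rw [List.length_append] at hlen
  have hpos := List.length_pos_iff_ne_nil.2 hu
  exact not_square_of_hasNoSquare rfl h hu hpos (by omega) hw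

theorem P0_two : P0 2 = [0, 1, 0, 2, 0, 1] :=
  P0_eq (k := 6) (v := [0, 1, 0, 2, 0, 1, 2]) (squareFree_of_hasNoSquare (by decide +kernel))
    (greedyAfter_of_periods (by decide) (by decide +kernel)) rfl
    (prefixOf_ruler_le (n := 3) (by norm_num))
    (by rw [prefixOf_ruler_le (n := 3) (by norm_num)]; decide)

theorem P0_three : P0 3 = [0, 1, 0, 2, 0, 1, 0, 3, 0, 1, 0, 2, 0, 1] :=
  P0_eq (k := 14) (v := [0, 1, 0, 2, 0, 1, 0, 3, 0, 1, 0, 2, 0, 1, 2])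
    (squareFree_of_hasNoSquare (by decide +kernel))
    (greedyAfter_of_periods (by decide) (by decide +kernel)) rfl
    (prefixOf_ruler_le (n := 4) (by norm_num))
    (by rw [prefixOf_ruler_le (n := 4) (by norm_num)]; decide)

theorem psi1_one : psi1 1 = 2 :: [0, 1, 0, 2, 0, 1] := by
  rw [← P0_two]; rfl

theorem psi1_two : psi1 2 = 3 :: [0, 1, 0, 2, 0, 1, 0, 3, 0, 1, 0, 2, 0, 1] := by
  rw [← P0_three]; rfl

theorem psi2_one : psi2 1 = 3 :: ([0, 1, 0, 2, 0, 1, 0, 3, 0, 1, 0, 2, 0, 1] ++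
    (psi1 0 ++ (psi1 1 ++ (psi1 0 ++ (psi1 2 ++ (psi1 0 ++ psi1 1)))))) := by
  have h : psi2 1 = 3 :: (P0 3 ++ (P0 2).flatMap psi1) := rfl
  rw [h, P0_two, P0_three]
  simp [List.flatMap_cons]

set_option maxRecDepth 100000 in
theorem B0_eq : B0 = B0Digits := by
  simp only [B0, List.flatMap_cons, List.flatMap_nil, psi2_one, psi1_one, psi1_two]
  decide +kernel

theorem B1_eq : B1 = B1Digits := by rw [B1, B0_eq, B1Digits]

theorem alpha_zero : alpha 0 = alphaZeroDigits := by
  rw [alpha, E, F, B0_eq]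
  rfl

theorem succWord_append (w : List ℕ) (a : ℕ) : succWord (w ++ [a]) = w ++ [a + 1] := by
  induction w with
  | nil => rfl
  | cons b w ih => cases w <;> simp_all [succWord]

/-- For `n ≥ 1` this is `α(n)` without its last letter `n + 3`, and for `n = 0` it is `B1` without
its last letter `4`; so `alphaCore n` followed by `n + 4` is `B1` or the successor of `α(n)`. -/
def alphaCore : ℕ → List ℕ
  | 0 => B1Digits.dropLast
  | n + 1 => alphaCore n ++ (n + 4) :: (rulerCore (n + 4) ++ (n + 4) ::
      (C ++ alphaCore n ++ (n + 4) :: rulerCore (n + 4)))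

theorem alphaCore_succ (n : ℕ) : alphaCore (n + 1) =
    alphaCore n ++ (n + 4) :: (rulerCore (n + 4) ++ (n + 4) ::
      (C ++ alphaCore n ++ (n + 4) :: rulerCore (n + 4))) := rfl

set_option maxRecDepth 100000 in
theorem B1Digits_eq : B1Digits = alphaCore 0 ++ [4] := by
  rw [alphaCore]
  decide +kernel

theorem alpha_succ (n : ℕ) : alpha (n + 1) = alphaCore (n + 1) ++ [n + 4] := by
  induction n with
  | zero =>
    rw [alphaCore_succ, alpha, B1_eq, B1Digits_eq, R_eq]
    simp
  | succ n ih =>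
    rw [alphaCore_succ (n + 1), alpha, ih, succWord_append, R_eq]
    simp

theorem alphaCore_one : alphaCore 1 = alphaOneCore := by
  rw [alphaOneCore, B1Digits_eq, R_eq, alphaCore_succ]
  simp

/-- The image under `α` of the ruler word `R n` without its last letter. -/
noncomputable def imagePrefix (n : ℕ) : List ℕ := (rulerCore n).flatMap alpha

theorem imagePrefix_succ (n : ℕ) :
    imagePrefix (n + 1) = imagePrefix n ++ alpha n ++ imagePrefix n := by
  simp [imagePrefix, rulerCore, List.flatMap_cons]

theorem imagePrefix_one : imagePrefix 1 = alphaZeroDigits := by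
  simp [imagePrefix, rulerCore, alpha_zero]

theorem prefix_imagePrefix (n : ℕ) : alphaZeroDigits <+: imagePrefix (n + 1) := by
  induction n with
  | zero => rw [imagePrefix_one]
  | succ n ih =>
    rw [imagePrefix_succ, List.append_assoc]
    exact ih.trans (List.prefix_append _ _)

theorem suffix_imagePrefix (n : ℕ) : alphaZeroDigits <:+ imagePrefix (n + 1) := by
  induction n with
  | zero => rw [imagePrefix_one]
  | succ n ih =>
    rw [imagePrefix_succ]
    exact ih.trans (List.suffix_append _ _)

set_option maxRecDepth 100000 in
theorem exists_alphaZeroDigits_eq_prefix :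
    ∃ x, alphaZeroDigits = [0, 1, 0, 2, 0, 3, 0, 1, 2] ++ x :=
  ⟨alphaZeroDigits.drop 9, by decide +kernel⟩

set_option maxRecDepth 100000 in
theorem exists_alphaZeroDigits_eq_suffix : ∃ x, alphaZeroDigits = x ++ [1, 2] :=
  ⟨alphaZeroDigits.take 3224, by decide +kernel⟩

/-! ### Letters of the words -/

set_option maxRecDepth 100000 in
theorem lt_five_of_mem_Y1Digits {a : ℕ} (h : a ∈ Y1Digits) : a < 5 := by
  have h1 : Y1Digits.all (fun a => Nat.blt a 5) = true := by decide +kernel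
  exact Nat.le_of_ble_eq_true (List.all_eq_true.1 h1 a h)

set_option maxRecDepth 100000 in
theorem lt_five_of_mem_alphaZeroDigits {a : ℕ} (h : a ∈ alphaZeroDigits) : a < 5 := by
  have h1 : alphaZeroDigits.all (fun a => Nat.blt a 5) = true := by decide +kernel
  exact Nat.le_of_ble_eq_true (List.all_eq_true.1 h1 a h)

set_option maxRecDepth 100000 in
theorem lt_five_of_mem_B1Digits {a : ℕ} (h : a ∈ B1Digits) : a < 5 := by
  have h1 : B1Digits.all (fun a => Nat.blt a 5) = true := by decide +kernel
  exact Nat.le_of_ble_eq_true (List.all_eq_true.1 h1 a h)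

theorem lt_five_of_mem_C {a : ℕ} (h : a ∈ C) : a < 5 := by
  have h1 : ∀ a ∈ C, a < 5 := by decide
  exact h1 a h

theorem lt_of_mem_alphaCore {n a : ℕ} (h : a ∈ alphaCore n) : a < max 5 (n + 4) := by
  induction n with
  | zero =>
    have := lt_five_of_mem_B1Digits (List.mem_of_mem_dropLast h)
    omega
  | succ n ih =>
    simp only [alphaCore, List.mem_append, List.mem_cons] at h
    rcases h with h | rfl | h | rfl | (h | h) | rfl | h
    · have := ih h; omega
    · omega
    · have := lt_of_mem_rulerCore h; omega
    · omega
    · have := lt_five_of_mem_C h; omega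
    · have := ih h; omega
    · omega
    · have := lt_of_mem_rulerCore h; omega

theorem lt_of_mem_imagePrefix {n a : ℕ} (h : a ∈ imagePrefix n) : a < max 5 (n + 3) := by
  obtain ⟨k, hk, ha⟩ := List.mem_flatMap.1 h
  have hk := lt_of_mem_rulerCore hk
  cases k with
  | zero =>
    rw [alpha_zero] at ha
    have := lt_five_of_mem_alphaZeroDigits ha
    omega
  | succ k =>
    rw [alpha_succ, List.mem_append, List.mem_singleton] at ha
    rcases ha with ha | rfl
    · have := lt_of_mem_alphaCore ha
      omega
    · omega

/-! ### Square-freeness -/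

theorem length_lt_of_prefixes_ne {p q t x y s b : List ℕ} (h1 : p ++ x = t ++ s)
    (h2 : q ++ y = t ++ b) (hl : p.length = q.length) (hne : p ≠ q) : t.length < p.length := by
  by_contra hlt
  have e1 := congrArg (List.take p.length) h1
  have e2 := congrArg (List.take p.length) h2
  rw [List.take_append_of_le_length (by omega), List.take_append_of_le_length (by omega),
    List.take_of_length_le (by omega)] at e1 e2
  exact hne (e1.trans e2.symm)

theorem length_lt_of_suffixes_ne {p q s x y a b : List ℕ} (h1 : x ++ p = a ++ s)
    (h2 : y ++ q = b ++ s) (hl : p.length = q.length) (hne : p ≠ q) : s.length < p.length := by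
  have := length_lt_of_prefixes_ne (p := p.reverse) (q := q.reverse) (t := s.reverse)
    (x := x.reverse) (y := y.reverse) (s := a.reverse) (b := b.reverse)
    (by simpa using congrArg List.reverse h1) (by simpa using congrArg List.reverse h2)
    (by simpa using hl) (by simpa using hne)
  simpa using this

set_option maxRecDepth 100000 in
/-- The longest common suffix of `alphaCore n` and `rulerCore (n + 4)` lacks exactly the first six
letters of the latter. -/
theorem exists_common_suffix (n : ℕ) : ∃ S z, rulerCore (n + 4) = [0, 1, 0, 2, 0, 1] ++ S ∧
    alphaCore n = 0 :: (z ++ 2 :: S) := by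
  induction n with
  | zero =>
    refine ⟨(rulerCore 4).drop 6, (alphaCore 0).tail.take 1560, by decide, ?_⟩
    rw [alphaCore]
    decide +kernel
  | succ n ih =>
    obtain ⟨S, z, h1, h2⟩ := ih
    refine ⟨S ++ (n + 4) :: rulerCore (n + 4), z ++ 2 :: (S ++ (n + 4) :: (rulerCore (n + 4) ++
      (n + 4) :: (C ++ 0 :: z))), ?_, ?_⟩
    · rw [show n + 1 + 4 = n + 4 + 1 by ring, rulerCore]
      conv_lhs => lhs; rw [h1]
      simp
    · rw [alphaCore, h2]
      simp

/-- The ruler word without its last letter is not a product of a prefix of `010203⋯` and a suffix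
of a word ending in `alphaCore n`: the former is too short by one letter. -/
theorem no_pieces_around_rulerCore {n : ℕ} {t s a b x y : List ℕ}
    (hr : rulerCore (n + 4) = t ++ s) (hp : x ++ alphaCore n = a ++ s)
    (hq : [0, 1, 0, 2, 0, 3] ++ y = t ++ b) : False := by
  obtain ⟨S, z, h1, h2⟩ := exists_common_suffix n
  have ht := length_lt_of_prefixes_ne (p := [0, 1, 0, 2, 0, 1]) (q := [0, 1, 0, 2, 0, 3])
    (h1 ▸ hr) hq rfl (by decide)
  have hs := length_lt_of_suffixes_ne (p := 1 :: S) (q := 2 :: S) (x := [0, 1, 0, 2, 0])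
    (y := x ++ 0 :: z) (a := t) (b := a) (by rw [← hr, h1]; rfl) (by rw [← hp, h2]; simp) rfl
    (by simp)
  have hlen := congrArg List.length (h1.symm.trans hr)
  simp only [List.length_append, List.length_cons, List.length_nil] at *
  omega

/-- A word `010203⋯` at least six letters longer than the ruler word is not a product of a prefix
and a suffix of the latter. -/
theorem no_pieces_between_rulerCores {n : ℕ} {t s a b x : List ℕ}
    (hx : [0, 1, 0, 2, 0, 3] ++ x = t ++ s) (hlen : (rulerCore (n + 4)).length ≤ x.length)
    (ha : rulerCore (n + 4) = a ++ s) (hb : rulerCore (n + 4) = t ++ b) : False := by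
  obtain ⟨S, z, h1, h2⟩ := exists_common_suffix n
  have ht := length_lt_of_prefixes_ne (p := [0, 1, 0, 2, 0, 1]) (q := [0, 1, 0, 2, 0, 3])
    (h1 ▸ hb) hx rfl (by decide)
  have hl1 := congrArg List.length hx
  have hl2 := congrArg List.length ha
  simp only [List.length_append, List.length_cons, List.length_nil] at *
  omega

theorem exists_imagePrefix_eq (n : ℕ) :
    (∃ x, imagePrefix (n + 1) = [0, 1, 0, 2, 0, 3, 0, 1, 2] ++ x ∧ 3217 ≤ x.length) ∧
      ∃ x, imagePrefix (n + 1) = x ++ [1, 2] := by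
  constructor
  · obtain ⟨x, hx⟩ := exists_alphaZeroDigits_eq_prefix
    obtain ⟨y, hy⟩ := prefix_imagePrefix n
    refine ⟨x ++ y, by rw [← hy, hx, List.append_assoc], ?_⟩
    have h := length_alphaZeroDigits
    rw [hx] at h
    simp only [List.length_append, List.length_cons, List.length_nil] at h ⊢
    omega
  · obtain ⟨x, hx⟩ := exists_alphaZeroDigits_eq_suffix
    obtain ⟨y, hy⟩ := suffix_imagePrefix n
    exact ⟨y ++ x, by rw [← hy, hx, List.append_assoc]⟩

theorem length_rulerCore_le_alphaCore (n : ℕ) :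
    (rulerCore (n + 4)).length ≤ (alphaCore n).length + 4 := by
  obtain ⟨S, z, h1, h2⟩ := exists_common_suffix n
  rw [h1, h2]
  simp only [List.length_append, List.length_cons, List.length_nil]
  omega

/-- The word `C K` is not a product of a prefix that it shares with a word starting like `α(0)` and
a suffix that it shares with a word ending in the last letters of `α(0)` followed by `K`: the first
has at most 8 letters and the second exceeds `K` by at most 1. -/
theorem no_pieces_around_C {K V t s a b x : List ℕ} (hC : C ++ K = t ++ s)
    (hV : [0, 1, 0, 2, 0, 3, 0, 1, 2] ++ V = t ++ b) (hx : x ++ [1, 2] ++ K = a ++ s) : False := by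
  have ht := length_lt_of_prefixes_ne (p := [0, 1, 0, 2, 0, 3, 0, 1, 0]) (x := 2 :: K) hC hV rfl
    (by decide)
  have hs := length_lt_of_suffixes_ne (p := [0, 2] ++ K) (q := [1, 2] ++ K)
    (x := [0, 1, 0, 2, 0, 3, 0, 1]) (y := x) (a := t) (b := a) hC (by rw [← hx]; simp) rfl
    (by simp)
  have hlen := congrArg List.length hC
  simp only [C, List.length_append, List.length_cons, List.length_nil] at *
  omega

/-- The counterpart of `no_pieces_around_C` with the roles of `C` and the image exchanged. -/
theorem no_pieces_around_image {K I t s a b x y : List ℕ} (hI : I = x ++ [1, 2])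
    (hV : I ++ K = t ++ s) (hI' : I = [0, 1, 0, 2, 0, 3, 0, 1, 2] ++ y) (hlen : 20 ≤ I.length)
    (ha : C ++ K = a ++ s) (hb : C ++ K = t ++ b) : False := by
  have ht := length_lt_of_prefixes_ne (p := [0, 1, 0, 2, 0, 3, 0, 1, 0]) (x := 2 :: K)
    (q := [0, 1, 0, 2, 0, 3, 0, 1, 2]) (y := y ++ K) (s := b) (b := s) hb
    (by rw [← hV, hI', List.append_assoc]) rfl (by decide)
  have hs := length_lt_of_suffixes_ne (p := [0, 2] ++ K) (q := [1, 2] ++ K)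
    (x := [0, 1, 0, 2, 0, 3, 0, 1]) (y := x) (a := a) (b := t) ha (by rw [← hV, hI]; simp) rfl
    (by simp)
  have hl := congrArg List.length hV
  simp only [List.length_append, List.length_cons, List.length_nil] at *
  omega

theorem squareFree_C_append_alphaCore {n : ℕ} (hn : 1 ≤ n) (h : SquareFree (C ++ alphaCore n)) :
    SquareFree (C ++ alphaCore (n + 1)) := by
  have e : C ++ alphaCore (n + 1) = sepJoin (n + 4) [C ++ alphaCore n, rulerCore (n + 4),
      C ++ alphaCore n, rulerCore (n + 4)] := by
    simp [alphaCore_succ, sepJoin]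
  have hm1 : n + 4 ∉ rulerCore (n + 4) := fun h => lt_irrefl _ (lt_of_mem_rulerCore h)
  have hm2 : n + 4 ∉ C ++ alphaCore n := by
    intro h
    rcases List.mem_append.1 h with h | h
    · have := lt_five_of_mem_C h; omega
    · have := lt_of_mem_alphaCore h; omega
  have hlen := length_rulerCore_le_alphaCore n
  have hC : C ++ alphaCore n = [0, 1, 0, 2, 0, 3] ++ ([0, 1, 0, 2] ++ alphaCore n) := rfl
  have hl : (rulerCore (n + 4)).length ≤ ([0, 1, 0, 2] ++ alphaCore n).length := by
    simp only [List.length_append, List.length_cons, List.length_nil]; omega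
  rw [e]
  refine squareFree_sepJoin (by
    simp only [List.forall_mem_cons, List.not_mem_nil, false_imp_iff, implies_true, and_true]
    exact ⟨hm2, hm1, hm2, hm1⟩) (by simp) ?_ ?_
  · simp [h, squareFree_rulerCore]
  · intro A a s M t b B hP
    rcases M with _ | ⟨M0, M⟩
    · rcases A with _ | ⟨A0, _ | ⟨A1, A⟩⟩ <;>
        simp only [List.nil_append, List.cons_append, List.cons.injEq] at hP
      · exact no_pieces_around_rulerCore hP.2.1 hP.1 (hC ▸ hP.2.2.1)
      · exact no_pieces_between_rulerCores (hC ▸ hP.2.2.1) hl hP.2.1 hP.2.2.2.1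
      · have := congrArg List.length hP.2.2
        simp at this
        omega
    · have := congrArg List.length hP
      simp at this
      omega

/-- The induction step for the prefixes of `Y1 α(ruler)`. The word is cut at the occurrences of
`n + 4` into eight pieces, and a square containing `n + 4` is located by its first piece and by the
list `M` of the pieces inside its root. -/
theorem squareFree_Y1_append {n : ℕ} (hn : 1 ≤ n)
    (h : SquareFree (Y1Digits ++ imagePrefix (n + 1) ++ alphaCore n))
    (hC : SquareFree (C ++ alphaCore n)) :
    SquareFree (Y1Digits ++ imagePrefix (n + 2) ++ alphaCore (n + 1)) := by
  have e : Y1Digits ++ imagePrefix (n + 2) ++ alphaCore (n + 1) = sepJoin (n + 4)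
      [Y1Digits ++ imagePrefix (n + 1) ++ alphaCore n, rulerCore (n + 4), C ++ alphaCore n,
        rulerCore (n + 4), imagePrefix (n + 1) ++ alphaCore n, rulerCore (n + 4), C ++ alphaCore n,
        rulerCore (n + 4)] := by
    rw [imagePrefix_succ (n + 1), alpha_succ]
    simp [alphaCore_succ, sepJoin]
  have hm1 : n + 4 ∉ rulerCore (n + 4) := fun h => lt_irrefl _ (lt_of_mem_rulerCore h)
  have hm0 : n + 4 ∉ alphaCore n := fun h => by have := lt_of_mem_alphaCore h; omega
  have hm2 : n + 4 ∉ C := fun h => by have := lt_five_of_mem_C h; omega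
  have hm3 : n + 4 ∉ Y1Digits := fun h => by have := lt_five_of_mem_Y1Digits h; omega
  have hm4 : n + 4 ∉ imagePrefix (n + 1) := fun h => by have := lt_of_mem_imagePrefix h; omega
  have hlen := length_rulerCore_le_alphaCore n
  obtain ⟨⟨y, hy, hylen⟩, x, hx⟩ := exists_imagePrefix_eq n
  obtain ⟨S, z, hS, -⟩ := exists_common_suffix n
  have h5 : C ++ alphaCore n = [0, 1, 0, 2, 0, 3] ++ ([0, 1, 0, 2] ++ alphaCore n) := rfl
  have h6 : imagePrefix (n + 1) ++ alphaCore n =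
      [0, 1, 0, 2, 0, 3] ++ ([0, 1, 2] ++ y ++ alphaCore n) := by rw [hy]; simp
  have hl5 : (rulerCore (n + 4)).length ≤ ([0, 1, 0, 2] ++ alphaCore n).length := by
    simp only [List.length_append, List.length_cons, List.length_nil]; omega
  have hl6 : (rulerCore (n + 4)).length ≤ ([0, 1, 2] ++ y ++ alphaCore n).length := by
    simp only [List.length_append, List.length_cons, List.length_nil]; omega
  have h7 : imagePrefix (n + 1) ++ alphaCore n =
      [0, 1, 0, 2, 0, 3, 0, 1, 2] ++ (y ++ alphaCore n) := by rw [hy]; simp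
  have hne1 : C ++ alphaCore n ≠ imagePrefix (n + 1) ++ alphaCore n := by
    rw [h7]; simp [C]
  have hne2 : rulerCore (n + 4) ≠ C ++ alphaCore n := by
    rw [hS]; simp [C]
  have hne3 : rulerCore (n + 4) ≠ imagePrefix (n + 1) ++ alphaCore n := by
    rw [hS, h7]; simp
  rw [e]
  refine squareFree_sepJoin (by simp [hm0, hm1, hm2, hm3, hm4]) (by simp) ?_ ?_
  · have hV : SquareFree (imagePrefix (n + 1) ++ alphaCore n) :=
      h.of_infix ⟨Y1Digits, [], by simp⟩
    intro p hp
    simp only [List.mem_cons, List.not_mem_nil, or_false] at hp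
    have hr := squareFree_rulerCore (n + 4)
    rcases hp with rfl | rfl | rfl | rfl | rfl | rfl | rfl | rfl <;> assumption
  · intro A a s M t b B hP
    have hlen := congrArg List.length hP
    rcases M with _ | ⟨M0, _ | ⟨M1, _ | ⟨M2, M⟩⟩⟩
    · rcases A with _ | ⟨_, _ | ⟨_, _ | ⟨_, _ | ⟨_, _ | ⟨_, _ | ⟨_, A⟩⟩⟩⟩⟩⟩ <;>
        simp only [List.nil_append, List.cons_append, List.cons.injEq] at hP
      · obtain ⟨h0, h1, h2, -⟩ := hP
        exact no_pieces_around_rulerCore h1 h0 (h5 ▸ h2)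
      · obtain ⟨-, h0, h1, h2, -⟩ := hP
        exact no_pieces_between_rulerCores (h5 ▸ h1) hl5 h0 h2
      · obtain ⟨-, -, h0, h1, h2, -⟩ := hP
        exact no_pieces_around_rulerCore h1 h0 (h6 ▸ h2)
      · obtain ⟨-, -, -, h0, h1, h2, -⟩ := hP
        exact no_pieces_between_rulerCores (h6 ▸ h1) hl6 h0 h2
      · obtain ⟨-, -, -, -, h0, h1, h2, -⟩ := hP
        exact no_pieces_around_rulerCore h1 h0 (h5 ▸ h2)
      · obtain ⟨-, -, -, -, -, h0, h1, h2, -⟩ := hP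
        exact no_pieces_between_rulerCores (h5 ▸ h1) hl5 h0 h2
      · simp at hlen
        omega
    · rcases A with _ | ⟨_, _ | ⟨_, _ | ⟨_, _ | ⟨_, A⟩⟩⟩⟩ <;>
        simp only [List.nil_append, List.cons_append, List.cons.injEq] at hP
      · obtain ⟨h0, -, h1, -, h2, -⟩ := hP
        exact no_pieces_around_C h1 (h7 ▸ h2) (x := Y1Digits ++ x)
          (by rw [← h0, hx]; simp)
      · obtain ⟨-, -, h0, -, h1, -⟩ := hP
        exact hne1 (h0.trans h1.symm)
      · obtain ⟨-, -, h0, -, h1, -, h2, -⟩ := hP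
        exact no_pieces_around_image hx h1 hy (by rw [hy, List.length_append]; omega) h0 h2
      · obtain ⟨-, -, -, -, h0, -, h1, -⟩ := hP
        exact hne1 (h1.trans h0.symm)
      · simp at hlen
        omega
    · rcases A with _ | ⟨_, _ | ⟨_, A⟩⟩ <;>
        simp only [List.nil_append, List.cons_append, List.cons.injEq] at hP
      · obtain ⟨-, h0, -, -, h1, -⟩ := hP
        exact hne3 (h0.trans h1.symm)
      · obtain ⟨-, -, h0, -, -, h1, -⟩ := hP
        exact hne2 (h1.trans h0.symm)
      · simp at hlen
        omega
    · simp at hlen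
      omega

theorem squareFree_induction (n : ℕ) :
    SquareFree (Y1Digits ++ imagePrefix (n + 2) ++ alphaCore (n + 1)) ∧
      SquareFree (C ++ alphaCore (n + 1)) := by
  induction n with
  | zero =>
    rw [zero_add, alphaCore_one]
    refine ⟨?_, squareFree_C_append_alphaOneCore⟩
    have h := squareFree_startWord
    rw [startWord] at h
    rw [imagePrefix_succ, imagePrefix_one, alpha_succ 0, alphaCore_one]
    simpa using h
  | succ n ih =>
    exact ⟨squareFree_Y1_append (by omega) ih.1 ih.2,
      squareFree_C_append_alphaCore (by omega) ih.2⟩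

/-! ### Greediness -/

set_option maxRecDepth 100000 in
/-- The common prefix `01020301` of `C` and `α(0)` is greedy after the end of any `α(n)`. The square
excluding the letter 1 in place of 3 has period `2 ^ (n + 4)`. -/
theorem greedyAfter_common_prefix (n : ℕ) :
    GreedyAfter (alphaCore n ++ (n + 4) :: R (n + 4)) [0, 1, 0, 2, 0, 3, 0, 1] := by
  obtain ⟨S, z, h1, h2⟩ := exists_common_suffix n
  have e1 : GreedyAfter [] [0, 1, 0, 2, 0] :=
    greedyAfter_of_periods (by decide) (by decide +kernel)
  have e2 : GreedyAfter [0, 1, 0, 2, 0, 3] [0, 1] :=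
    greedyAfter_of_periods (by decide) (by decide +kernel)
  refine GreedyAfter.append (v := [0, 1, 0, 2, 0]) (by simpa using e1.mono _)
    (GreedyAfter.append (v := [3]) (GreedyAfter.singleton fun b hb => ?_)
      (by simpa using e2.mono (alphaCore n ++ (n + 4) :: R (n + 4))))
  interval_cases b
  · exact hasSquareSuffix_of_eq (u := [0]) (by simp)
      (x := alphaCore n ++ (n + 4) :: R (n + 4) ++ [0, 1, 0, 2]) (by simp)
  · exact hasSquareSuffix_of_eq (u := S ++ (n + 4) :: [0, 1, 0, 2, 0, 1]) (by simp)
      (x := 0 :: (z ++ [2])) (by rw [R_eq, h1, h2]; simp)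
  · exact hasSquareSuffix_of_eq (u := [0, 2]) (by simp)
      (x := alphaCore n ++ (n + 4) :: R (n + 4) ++ [0, 1]) (by simp)

theorem greedyAfter_C (n : ℕ) : GreedyAfter (alphaCore n ++ (n + 4) :: R (n + 4)) C := by
  have e : GreedyAfter [0, 1, 0, 2, 0, 3, 0, 1] [0, 2] :=
    greedyAfter_of_periods (by decide) (by decide +kernel)
  exact (greedyAfter_common_prefix n).append (w := [0, 2]) (e.mono _)

theorem greedyAfter_R (c : List ℕ) (n : ℕ) : GreedyAfter c (R n) := by
  simpa using (greedyAfter_nil_R n).mono c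

theorem greedyAfter_alpha_of {c : List ℕ} {n : ℕ} (hc : GreedyAfter c (alphaCore n ++ [n + 4]))
    (hC : GreedyAfter C (alphaCore n ++ [n + 4])) : GreedyAfter c (alpha (n + 1)) := by
  have e : alpha (n + 1) = (alphaCore n ++ [n + 4]) ++ (R (n + 4) ++ (C ++
      ((alphaCore n ++ [n + 4]) ++ R (n + 4)))) := by
    rw [alpha_succ, alphaCore_succ, R_eq]
    simp
  rw [e]
  refine hc.append ((greedyAfter_R _ _).append (GreedyAfter.append ?_ (GreedyAfter.append ?_
    (greedyAfter_R _ _))))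
  · simpa using (greedyAfter_C n).mono c
  · exact hC.mono _

theorem greedyAfter_C_alphaCore (n : ℕ) : GreedyAfter C (alphaCore n ++ [n + 4]) := by
  induction n with
  | zero =>
    rw [← B1Digits_eq]
    exact greedyAfter_C_B1Digits
  | succ n ih =>
    refine GreedyAfter.succ_last ?_ ?_
    · rw [← alpha_succ]
      exact greedyAfter_alpha_of ih ih
    · exact hasSquareSuffix_of_eq (x := []) (by simp)
        (u := C ++ (alphaCore n ++ (n + 4) :: (rulerCore (n + 4) ++ [n + 4])))
        (by rw [alphaCore_succ]; simp)

theorem suffix_imagePrefix_of_le {m n : ℕ} (h : m ≤ n) : imagePrefix m <:+ imagePrefix n := by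
  induction n, h using Nat.le_induction with
  | base => exact List.suffix_refl _
  | succ n _ ih =>
    rw [imagePrefix_succ]
    exact ih.trans (List.suffix_append _ _)

theorem GreedyAfter.of_suffix {c d w : List ℕ} (h : GreedyAfter c w) (hd : c <:+ d) :
    GreedyAfter d w := by
  obtain ⟨x, rfl⟩ := hd
  exact h.mono x

/-- For `1 ≤ n < k`, the successor of `α(n)` is greedy after the image of `R k` without its last
letter: since this image ends in that of `R n`, `α(n)` itself would end in a square, the image of a
square `R n R n`. -/
theorem greedyAfter_imagePrefix_alphaCore (n k : ℕ) (h : n < k) :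
    GreedyAfter (imagePrefix k) (alphaCore n ++ [n + 4]) := by
  induction n with
  | zero =>
    obtain ⟨k, rfl⟩ := Nat.exists_eq_add_of_lt h
    rw [← B1Digits_eq, zero_add]
    exact greedyAfter_alphaZeroDigits_B1Digits.of_suffix (suffix_imagePrefix k)
  | succ n ih =>
    refine GreedyAfter.succ_last ?_ ?_
    · rw [← alpha_succ]
      exact greedyAfter_alpha_of (ih (by omega)) (greedyAfter_C_alphaCore n)
    · rw [List.append_assoc, ← alpha_succ]
      obtain ⟨x, hx⟩ := suffix_imagePrefix_of_le h
      refine hasSquareSuffix_of_eq (x := x) (u := imagePrefix (n + 1) ++ alpha (n + 1)) ?_ ?_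
      · simp [alpha_succ]
      · rw [← hx, imagePrefix_succ]
        simp

theorem greedyAfter_imagePrefix_alpha (n : ℕ) :
    GreedyAfter (imagePrefix (n + 1)) (alpha (n + 1)) :=
  greedyAfter_alpha_of (greedyAfter_imagePrefix_alphaCore n (n + 1) n.lt_succ_self)
    (greedyAfter_C_alphaCore n)

set_option maxRecDepth 100000 in
theorem alphaZeroDigits_eq :
    alphaZeroDigits = [0, 1, 0, 2, 0, 3, 0, 1] ++ ([2] ++ alphaZeroDigits.drop 9) := by
  decide +kernel

theorem alphaZeroDigits_take : alphaZeroDigits.take 9 = [0, 1, 0, 2, 0, 3, 0, 1, 2] := by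
  rw [alphaZeroDigits_eq]
  rfl

/-- After `α(0) α(n)` with `n ≥ 1`, the word `α(0)` is greedy: its prefix `01020301` continues like
`C`, and the letter 0 in place of the next one completes a square of half the length of
`α(n) C`. -/
theorem greedyAfter_alpha_alphaZero (n : ℕ) :
    GreedyAfter (alphaZeroDigits ++ alpha (n + 1)) alphaZeroDigits := by
  obtain ⟨x, hx⟩ := exists_alphaZeroDigits_eq_suffix
  have ha : alpha (n + 1) = alphaCore n ++ (n + 4) :: (rulerCore (n + 4) ++ (n + 4) ::
      (C ++ (alphaCore n ++ (n + 4) :: R (n + 4)))) := by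
    rw [alpha_succ, alphaCore_succ, R_eq]
    simp
  have key : GreedyAfter (alphaZeroDigits ++ alpha (n + 1))
      ([0, 1, 0, 2, 0, 3, 0, 1] ++ ([2] ++ alphaZeroDigits.drop 9)) := ?_
  · rwa [← alphaZeroDigits_eq] at key
  refine GreedyAfter.append ?_ (GreedyAfter.append (GreedyAfter.singleton fun b hb => ?_) ?_)
  · rw [ha]
    refine (greedyAfter_common_prefix n).of_suffix ⟨alphaZeroDigits ++ (alphaCore n ++ (n + 4) ::
      (rulerCore (n + 4) ++ (n + 4) :: C)), by simp⟩
  · interval_cases b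
    · refine hasSquareSuffix_of_eq (x := x ++ [1]) (u := 2 :: (alphaCore n ++ (n + 4) ::
        (rulerCore (n + 4) ++ (n + 4) :: [0, 1, 0, 2, 0, 3, 0, 1, 0]))) (by simp) ?_
      rw [ha, hx, R_eq]
      simp [C]
    · exact hasSquareSuffix_of_eq (x := alphaZeroDigits ++ alpha (n + 1) ++ [0, 1, 0, 2, 0, 3, 0])
        (u := [1]) (by simp) (by simp)
  · have h := greedyAfter_take_drop
    rw [alphaZeroDigits_take] at h
    exact h.of_suffix ⟨alphaZeroDigits ++ alpha (n + 1), by simp⟩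

theorem greedyAfter_imagePrefix {c : List ℕ} (hc : GreedyAfter c alphaZeroDigits) (n : ℕ) :
    GreedyAfter c (imagePrefix n) := by
  induction n generalizing c with
  | zero => exact GreedyAfter.nil c
  | succ n ih =>
    cases n with
    | zero => rwa [imagePrefix_one]
    | succ n =>
      rw [imagePrefix_succ]
      refine ((ih hc).append ((greedyAfter_imagePrefix_alpha n).mono c)).append (ih ?_)
      obtain ⟨x, hx⟩ := suffix_imagePrefix n
      exact (greedyAfter_alpha_alphaZero n).of_suffix ⟨c ++ x, by rw [← hx]; simp⟩

/-! ### The words `L(1)` and `Y1 α(L(ε))` -/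

set_option maxRecDepth 100000 in
theorem Y1Digits_eq : Y1Digits = [1] ++ Y1Digits.tail := by decide +kernel

theorem prefixOf_L_one (n : ℕ) :
    prefixOf (L [1]) (5177 + (imagePrefix n).length) = Y1Digits ++ imagePrefix n := by
  have e : Y1Digits ++ imagePrefix n = [1] ++ (Y1Digits.tail ++ imagePrefix n) := by
    rw [← List.append_assoc, ← Y1Digits_eq]
  have hY : GreedyAfter Y1Digits alphaZeroDigits := by
    have h := greedyAfter_take_drop.mono Y1Digits
    simpa using greedyAfter_Y1Digits_take.append h
  have hs : SquareFree ([1] ++ (Y1Digits.tail ++ imagePrefix n)) := by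
    rw [← e]
    refine (squareFree_induction n).1.of_infix (List.IsPrefix.isInfix ?_)
    rw [imagePrefix_succ, imagePrefix_succ]
    simp
  have hg : GreedyAfter [1] (Y1Digits.tail ++ imagePrefix n) := by
    refine greedyAfter_one_Y1Digits.append ?_
    rw [← Y1Digits_eq]
    exact greedyAfter_imagePrefix hY n
  have h := prefixOf_L hs hg
  rwa [← e, List.length_append, length_Y1Digits] at h

theorem Y1_eq : Y1 = Y1Digits := by
  have h := prefixOf_L_one 0
  simpa [imagePrefix, rulerCore, Y1] using h

theorem prefixOf_ruler_prefix_rulerCore (k : ℕ) : prefixOf ruler k <+: rulerCore (k + 1) := by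
  have h1 : k < 2 ^ k := Nat.lt_two_pow_self
  have h2 := prefixOf_prefix ruler (show k ≤ 2 ^ k by omega)
  rw [prefixOf_ruler, R_eq] at h2
  exact h2.trans ⟨rulerCore k, by simp [rulerCore]⟩

theorem exists_image_ruler_eq (j : ℕ) :
    ∃ h : j < (imagePrefix (j + 2)).length,
      image alpha alpha_ne_nil ruler j = (imagePrefix (j + 2))[j] := by
  have hlt := le_length_flatMap_prefixOf alpha alpha_ne_nil ruler (j + 1)
  have hpre : (prefixOf ruler (j + 1)).flatMap alpha <+: imagePrefix (j + 2) := by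
    obtain ⟨x, hx⟩ := prefixOf_ruler_prefix_rulerCore (j + 1)
    exact ⟨x.flatMap alpha, by rw [imagePrefix, ← hx, List.flatMap_append]⟩
  exact ⟨lt_of_lt_of_le hlt hpre.length_le, hpre.getElem hlt⟩

end SqFree

theorem theorem1 :
    SqFree.L [] = SqFree.ruler ∧
    SqFree.L [1] =
      SqFree.append SqFree.Y1 (SqFree.image SqFree.alpha SqFree.alpha_ne_nil (SqFree.L [])) := by
  refine ⟨SqFree.L_nil, ?_⟩
  rw [SqFree.L_nil]
  funext i
  rw [SqFree.append]
  split_ifs with hi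
  · simp [SqFree.Y1]
  · have hlen : SqFree.Y1.length = 5177 := by simp [SqFree.Y1]
    obtain ⟨h, e⟩ := SqFree.exists_image_ruler_eq (i - SqFree.Y1.length)
    have hL := SqFree.prefixOf_L_one (i - SqFree.Y1.length + 2)
    rw [← SqFree.Y1_eq] at hL
    rw [e]
    have h1 := List.getElem_of_eq hL (i := i) (by simp; omega)
    rw [SqFree.getElem_prefixOf, List.getElem_append_right (by omega)] at h1
    exact h1
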